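/- Let $\lg$ denote $\log_2$, let $[m]=\{0,\dots,m-1\}$, and let $\mathcal B(n,m)=\lceil \lg\binom{m}{n}\rceil$. For a finite set $S$ of natural numbers let $\mathrm{rank}(x,S)=|\{y\in S: y<x\}|$ if $x\in S$ and $\mathrm{rank}(x,S)=-1$ otherwise, and for $1\le i\le |S|$ let $\mathrm{select}(i,S)$ be the $i$-th smallest element of $S$. The model of computation is the word RAM with word size $w=\Theta(\lg m)$: memory cells and registers hold $w$-bit words, with unit-cost arithmetic, bitwise, shift, comparison, jump and memory access instructions. There are four fixed word RAM programs and a constant $T$ such that for every $c$ there is a constant $C$ with the following property. Let $m\ge 3$, let the word size $w$ satisfy $m<2^w$ and $w\le c\lg m$, and let $S\subseteq[m]$ with $|S|=n$ and $\bar S=[m]\setminus S$. Then there is a bit string of length at most $$\mathcal B(n,m)+C\,\frac{m\lg\lg m}{\lg m}$$ such that, when it is stored in memory packed into $w$-bit words (followed by zeros), the four programs answer the queries $\mathrm{rank}(x,S)$ and $\mathrm{rank}(x,\bar S)$ for all $x\in[m]$, $\mathrm{select}(i,S)$ for all $1\le i\le n$, and $\mathrm{select}(i,\bar S)$ for all $1\le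 i\le m-n$, each within $T$ steps. That is, every $S\subseteq[m]$ with $|S|=n$ has a fully indexable dictionary (constant-time rank and select on $S$ and on its complement) using $\mathcal B(n,m)+O(m\lg\lg m/\lg m)$ bits. -/

import Mathlib

namespace FID

/-! ### The word RAM

A program is a fixed finite list of instructions.  It does not depend on the word size `w`; on a
machine of word size `w` all registers and all memory cells hold `w`-bit words. -/

/-- The arithmetic and bitwise instructions of the word RAM (all modulo `2 ^ w`). -/
inductive BinOp
  | add | sub | mul | div | mod | and | or | xor | shl | shr

/-- Words are unsigned; `x / 0 = 0`, `x % 0 = x`, and a shift by `w` or more gives `0`. -/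
def BinOp.eval {w : ℕ} : BinOp → BitVec w → BitVec w → BitVec w
  | .add, x, y => x + y
  | .sub, x, y => x - y
  | .mul, x, y => x * y
  | .div, x, y => x / y
  | .mod, x, y => x % y
  | .and, x, y => x &&& y
  | .or, x, y => x ||| y
  | .xor, x, y => x ^^^ y
  | .shl, x, y => x <<< y
  | .shr, x, y => x >>> y

/-- Instructions; `d`, `a`, `b` are names of registers, `t` is a line of the program.
There is no instruction that writes to memory: a query only reads the data structure, and its
working space is the registers that the program mentions. -/
inductive Instr
  /-- `d := k` -/
  | const (d k : ℕ)
  /-- `d := memory[a]` -/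
  | load (d a : ℕ)
  /-- `d := a o b` -/
  | op (o : BinOp) (d a b : ℕ)
  /-- go to line `t` -/
  | jump (t : ℕ)
  /-- if `a = b` go to line `t` -/
  | jeq (a b t : ℕ)
  /-- if `a < b` (unsigned) go to line `t` -/
  | jlt (a b t : ℕ)
  /-- stop with answer `a` -/
  | halt (a : ℕ)

abbrev Program := List Instr

/-- `run P mem T pc reg` executes `P` from line `pc` with registers `reg`, one time unit per
instruction.  It is `some y` if the program stops within `T` time units with answer `y`, and
`none` if it does not (or if it leaves the program). -/
def run {w : ℕ} (P : Program) (mem : ℕ → BitVec w) :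
    ℕ → ℕ → (ℕ → BitVec w) → Option (BitVec w)
  | 0, _, _ => none
  | T + 1, pc, reg =>
    match P[pc]? with
    | none => none
    | some (.const d k) => run P mem T (pc + 1) (Function.update reg d (BitVec.ofNat w k))
    | some (.load d a) => run P mem T (pc + 1) (Function.update reg d (mem (reg a).toNat))
    | some (.op o d a b) =>
        run P mem T (pc + 1) (Function.update reg d (o.eval (reg a) (reg b)))
    | some (.jump t) => run P mem T t reg
    | some (.jeq a b t) => run P mem T (if reg a = reg b then t else pc + 1) reg
    | some (.jlt a b t) =>
        run P mem T (if (reg a).toNat < (reg b).toNat then t else pc + 1) reg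
    | some (.halt a) => some (reg a)

/-- A bit string stored in consecutive memory cells, `w` bits per cell, least significant bit
first; all bits after its end are `0`. -/
def memOf (w : ℕ) (D : List Bool) (j : ℕ) : BitVec w :=
  BitVec.ofFnLE fun i : Fin w => D.getD (j * w + i) false

/-- On word size `w` and with the bit string `D` in memory, `P` answers the query `x` with `y`
within `T` time units.  The query is in register `0`; all other registers are initially `0`. -/
def Answers (P : Program) (T w : ℕ) (D : List Bool) (x : ℕ) (y : ℤ) : Prop :=
  run P (memOf w D) T 0 (Function.update (fun _ => 0) 0 (BitVec.ofNat w x)) =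
    some (BitVec.ofInt w y)

/-! ### Fully indexable dictionaries -/

/-- `-1` if `x ∉ S`, and the number of elements of `S` less than `x` otherwise. -/
def rank (x : ℕ) (S : Finset ℕ) : ℤ :=
  if x ∈ S then ((S.filter (· < x)).card : ℤ) else -1

/-- The `i`-th smallest element of `S`, for `1 ≤ i ≤ |S|`. -/
noncomputable def select (i : ℕ) (S : Finset ℕ) : ℕ :=
  Nat.nth (· ∈ S) (i - 1)

/-- The four query algorithms of a fully indexable dictionary. -/
structure Queries where
  rankS : Program
  selectS : Program
  rankCompl : Program
  selectCompl : Program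

/-- With the algorithms `Q`, on word size `w`, the bit string `D` is a representation of
`S ⊆ {0, …, m - 1}` that supports rank and select on `S` and on its complement, each query within
`T` time units.  (The answer `-1` is the word of `w` ones; it differs from every
number less than `m` if `m < 2 ^ w`.) -/
structure Represents (Q : Queries) (T w m : ℕ) (D : List Bool) (S : Finset ℕ) : Prop where
  rankS : ∀ x < m, Answers Q.rankS T w D x (rank x S)
  selectS : ∀ i, 1 ≤ i → i ≤ S.card → Answers Q.selectS T w D i (select i S)
  rankCompl : ∀ x < m, Answers Q.rankCompl T w D x (rank x (Finset.range m \ S))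
  selectCompl : ∀ i, 1 ≤ i → i ≤ (Finset.range m \ S).card →
    Answers Q.selectCompl T w D i (select i (Finset.range m \ S))

/-- Base two logarithm. -/
noncomputable def lg (x : ℝ) : ℝ := Real.logb 2 x

/-- The information-theoretic lower bound `⌈lg (m choose n)⌉`. -/
noncomputable def infoBound (n m : ℕ) : ℕ := ⌈lg (m.choose n)⌉₊

end FID

/-!
Cut the universe into blocks of length `t = ⌊lg m⌋ / 8` and store each block as its cardinality `k`
together with its number among the `k`-subsets of a `t`-set. As a product of binomial coefficients
is at most the binomial coefficient of the sums, these numbers take `⌈lg (m choose n)⌉ + O(m / t)`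
bits; the cardinalities and pointers, sampled every `t` blocks with offsets of `O(lg t)` bits, take
`O(m lg t / t)` bits. The number of a block has at most `t` bits, so tables with `2 ^ O(t)` entries,
far fewer than `m`, answer the queries inside a block.

Rank adds the stored rank of the block. Select needs the block `β i` of the `i`-th element, where
`β` is monotone with values at most `m / t`. It is stored in groups of `t ^ 2` values: a group over
which `β` increases by at least `t ^ 3` can afford a word for each value, and the other groups are
cut into subgroups of `t` values. A subgroup over which `β` increases by at least `t` can afford an
explicit offset of `O(lg t)` bits for each value; any other subgroup is one of at most `2 ^ (2 * t)`
monotone sequences and is stored by its number, which is again decoded by a table.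

Universes of bounded size are stored as a bitmap and scanned; the first memory word tells the two
representations apart.
-/

namespace FID

/-! ### Expressions and their compilation -/

/-- Loop-free computations on a single argument; `ite a b c e` is `c` if `a < b` and `e`
otherwise. -/
inductive Expr
  | arg
  | const (k : ℕ)
  | load (e : Expr)
  | op (o : BinOp) (a b : Expr)
  | ite (a b c e : Expr)

/-- The value of an expression with memory `mem` and argument `x`. -/
def Expr.eval {w : ℕ} (mem : ℕ → BitVec w) (x : BitVec w) : Expr → BitVec w
  | .arg => x
  | .const k => BitVec.ofNat w k
  | .load e => mem (e.eval mem x).toNat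
  | .op o a b => o.eval (a.eval mem x) (b.eval mem x)
  | .ite a b c e =>
      if (a.eval mem x).toNat < (b.eval mem x).toNat then c.eval mem x else e.eval mem x

/-- Code for an expression, placed at line `pc`; the argument is expected in register `0`, the
value is left in register `d`, and the registers below `d` are not changed. -/
def Expr.compile : Expr → ℕ → ℕ → List Instr
  | .arg, d, _ => [.op .or d 0 0]
  | .const k, d, _ => [.const d k]
  | .load e, d, pc => e.compile d pc ++ [.load d d]
  | .op o a b, d, pc =>
      let A := a.compile d pc
      let B := b.compile (d + 1) (pc + A.length)
      A ++ B ++ [.op o d d (d + 1)]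
  | .ite a b c e, d, pc =>
      let A := a.compile d pc
      let B := b.compile (d + 1) (pc + A.length)
      let q := pc + A.length + B.length
      let E := e.compile d (q + 1)
      let C := c.compile d (q + 1 + E.length + 1)
      A ++ B ++ [.jlt d (d + 1) (q + 1 + E.length + 1)] ++ E ++
        [.jump (q + 1 + E.length + 1 + C.length)] ++ C

/-- The list `Y` occurs in `D` at position `p`. -/
def ContainsAt {α : Type*} (D : List α) (p : ℕ) (Y : List α) : Prop := Y <+: D.drop p

namespace ContainsAt

variable {α : Type*} {D X Y Z : List α} {p q : ℕ}

theorem left (h : ContainsAt D p (X ++ Y)) : ContainsAt D p X :=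
  (List.prefix_append X Y).trans h

theorem right (h : ContainsAt D p (X ++ Y)) : ContainsAt D (p + X.length) Y := by
  obtain ⟨Z, hZ⟩ := h
  refine ⟨Z, ?_⟩
  rw [← List.drop_drop, ← hZ, List.append_assoc, List.drop_left]

theorem getElem? (h : ContainsAt D p Y) {i : ℕ} (hi : i < Y.length) : D[p + i]? = Y[i]? := by
  obtain ⟨Z, hZ⟩ := h
  rw [← List.getElem?_drop, ← hZ, List.getElem?_append_left hi]

theorem head {a : α} (h : ContainsAt D p [a]) : D[p]? = some a := by
  simpa using h.getElem? (i := 0) (by simp)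

theorem trans (h : ContainsAt D p Y) (h' : ContainsAt Y q Z) : ContainsAt D (p + q) Z := by
  obtain ⟨A, hA⟩ := h
  obtain ⟨B, hB⟩ := h'
  rw [ContainsAt, ← List.drop_drop, ← hA, List.drop_append, ← hB, List.append_assoc]
  exact List.prefix_append _ _

theorem append_right (h : ContainsAt X p Z) : ContainsAt (X ++ Y) p Z :=
  (zero_add p) ▸ trans (p := 0) (List.prefix_append X Y) h

theorem length_append (X Y : List α) : ContainsAt (X ++ Y) X.length Y := by
  rw [ContainsAt, List.drop_left]

end ContainsAt

section Steps

variable {w : ℕ} {P : Program} {mem : ℕ → BitVec w}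

theorem run_succ_of_run_eq_some {y : BitVec w} {T pc : ℕ} {reg : ℕ → BitVec w}
    (h : run P mem T pc reg = some y) : run P mem (T + 1) pc reg = some y := by
  induction T generalizing pc reg with
  | zero => simp [run] at h
  | succ T ih =>
    rw [run] at h ⊢
    cases hP : P[pc]? with
    | none => simp [hP] at h
    | some I =>
      rw [hP] at h
      cases I <;> first | exact ih h | exact h

theorem run_mono {y : BitVec w} {T T' pc : ℕ} {reg : ℕ → BitVec w} (hT : T ≤ T')
    (h : run P mem T pc reg = some y) : run P mem T' pc reg = some y := by
  induction hT with
  | refl => exact h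
  | step _ ih => exact run_succ_of_run_eq_some ih

/-- From line `pc` and registers `reg` the program arrives after `n` steps at `pc'`, `reg'`. -/
def Steps (P : Program) (mem : ℕ → BitVec w) (n pc : ℕ) (reg : ℕ → BitVec w) (pc' : ℕ)
    (reg' : ℕ → BitVec w) : Prop :=
  ∀ T, run P mem (T + n) pc reg = run P mem T pc' reg'

theorem Steps.trans {n n' pc pc' pc'' : ℕ} {reg reg' reg'' : ℕ → BitVec w}
    (h : Steps P mem n pc reg pc' reg') (h' : Steps P mem n' pc' reg' pc'' reg'') :
    Steps P mem (n + n') pc reg pc'' reg'' := fun T => by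
  rw [add_comm n, ← add_assoc, h, h']

variable {pc a b d t : ℕ} {reg : ℕ → BitVec w}

theorem steps_const {k : ℕ} (h : P[pc]? = some (.const d k)) :
    Steps P mem 1 pc reg (pc + 1) (Function.update reg d (BitVec.ofNat w k)) := fun T => by
  rw [run, h]

theorem steps_load (h : P[pc]? = some (.load d a)) :
    Steps P mem 1 pc reg (pc + 1) (Function.update reg d (mem (reg a).toNat)) := fun T => by
  rw [run, h]

theorem steps_op {o : BinOp} (h : P[pc]? = some (.op o d a b)) :
    Steps P mem 1 pc reg (pc + 1) (Function.update reg d (o.eval (reg a) (reg b))) := fun T => by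
  rw [run, h]

theorem steps_jump (h : P[pc]? = some (.jump t)) : Steps P mem 1 pc reg t reg := fun T => by
  rw [run, h]

theorem steps_jlt (h : P[pc]? = some (.jlt a b t)) :
    Steps P mem 1 pc reg (if (reg a).toNat < (reg b).toNat then t else pc + 1) reg := fun T => by
  rw [run, h]

end Steps

/-- From line `pc` with `x` in register `0`, the program arrives within `n` steps at line `pc'`
with `v` in register `d` and the registers below `d` as before. -/
def Delivers {w : ℕ} (P : Program) (mem : ℕ → BitVec w) (x : BitVec w) (d n pc pc' : ℕ)
    (v : BitVec w) : Prop :=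
  ∀ reg : ℕ → BitVec w, reg 0 = x → ∃ k ≤ n, ∃ reg',
    Steps P mem k pc reg pc' reg' ∧ reg' d = v ∧ ∀ r < d, reg' r = reg r

namespace Delivers

variable {w : ℕ} {P : Program} {mem : ℕ → BitVec w} {x u v y z : BitVec w}
  {d n₁ n₂ n₃ n₄ pc p₁ p₂ p₃ p₄ : ℕ}

theorem of_steps (h : ∀ reg : ℕ → BitVec w, reg 0 = x →
    Steps P mem 1 pc reg p₁ (Function.update reg d v)) : Delivers P mem x d 1 pc p₁ v :=
  fun reg hreg => ⟨1, le_rfl, _, h reg hreg, Function.update_self .., fun _ hr =>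
    Function.update_of_ne hr.ne ..⟩

theorem load (h : Delivers P mem x d n₁ pc p₁ v) (hP : P[p₁]? = some (.load d d)) :
    Delivers P mem x d (n₁ + 1) pc (p₁ + 1) (mem v.toNat) := fun reg hreg => by
  obtain ⟨k, hk, reg', hs, rfl, hr⟩ := h reg hreg
  refine ⟨k + 1, by gcongr, _, hs.trans (steps_load hP), Function.update_self .., fun r hrd => ?_⟩
  rw [Function.update_of_ne hrd.ne, hr r hrd]

theorem pair (hd : 0 < d) (h₁ : Delivers P mem x d n₁ pc p₁ u)
    (h₂ : Delivers P mem x (d + 1) n₂ p₁ p₂ v) (reg : ℕ → BitVec w) (hreg : reg 0 = x) :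
    ∃ k ≤ n₁ + n₂, ∃ reg', Steps P mem k pc reg p₂ reg' ∧ reg' d = u ∧ reg' (d + 1) = v ∧
      ∀ r < d, reg' r = reg r := by
  obtain ⟨k, hk, reg', hs, hu, hr⟩ := h₁ reg hreg
  obtain ⟨k', hk', reg'', hs', hv, hr'⟩ := h₂ reg' (by rw [hr 0 hd, hreg])
  refine ⟨k + k', by gcongr, reg'', hs.trans hs', ?_, hv, fun r hrd => ?_⟩
  · rw [hr' d d.lt_succ_self, hu]
  · rw [hr' r (hrd.trans d.lt_succ_self), hr r hrd]

theorem op {o : BinOp} (hd : 0 < d) (h₁ : Delivers P mem x d n₁ pc p₁ u)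
    (h₂ : Delivers P mem x (d + 1) n₂ p₁ p₂ v) (hP : P[p₂]? = some (.op o d d (d + 1))) :
    Delivers P mem x d (n₁ + n₂ + 1) pc (p₂ + 1) (o.eval u v) := fun reg hreg => by
  obtain ⟨k, hk, reg', hs, rfl, rfl, hr⟩ := pair hd h₁ h₂ reg hreg
  refine ⟨k + 1, by gcongr, _, hs.trans (steps_op hP), Function.update_self .., fun r hrd => ?_⟩
  rw [Function.update_of_ne hrd.ne, hr r hrd]

theorem ite (hd : 0 < d) (h₁ : Delivers P mem x d n₁ pc p₁ u)
    (h₂ : Delivers P mem x (d + 1) n₂ p₁ p₂ v) (hbranch : P[p₂]? = some (.jlt d (d + 1) (p₃ + 1)))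
    (h₃ : Delivers P mem x d n₃ (p₂ + 1) p₃ z) (hjump : P[p₃]? = some (.jump p₄))
    (h₄ : Delivers P mem x d n₄ (p₃ + 1) p₄ y) :
    Delivers P mem x d (n₁ + n₂ + 1 + n₃ + 1 + n₄) pc p₄ (if u.toNat < v.toNat then y else z) := by
  intro reg hreg
  obtain ⟨k, hk, reg', hs, rfl, rfl, hr⟩ := pair hd h₁ h₂ reg hreg
  have hs' := hs.trans (steps_jlt hbranch)
  have hreg' : reg' 0 = x := by rw [hr 0 hd, hreg]
  split_ifs with hlt
  · obtain ⟨k', hk', reg'', hs'', hv, hr'⟩ := h₄ reg' hreg'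
    rw [if_pos hlt] at hs'
    exact ⟨_, by lia, reg'', hs'.trans hs'', hv, fun r hrd => (hr' r hrd).trans (hr r hrd)⟩
  · obtain ⟨k', hk', reg'', hs'', hv, hr'⟩ := h₃ reg' hreg'
    rw [if_neg hlt] at hs'
    exact ⟨_, by lia, reg'', (hs'.trans hs'').trans (steps_jump hjump), hv,
      fun r hrd => (hr' r hrd).trans (hr r hrd)⟩

end Delivers

theorem Expr.compile_delivers {w : ℕ} {P : Program} {mem : ℕ → BitVec w} {x : BitVec w} (e : Expr)
    {d pc : ℕ} (hd : 0 < d) (h : ContainsAt P pc (e.compile d pc)) :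
    Delivers P mem x d (e.compile d pc).length pc (pc + (e.compile d pc).length)
      (e.eval mem x) := by
  induction e generalizing d pc with
  | arg =>
    refine .of_steps fun reg hreg => ?_
    have hcopy := steps_op (mem := mem) (reg := reg) h.head
    rw [BinOp.eval, BitVec.or_self, hreg] at hcopy
    exact hcopy
  | const k => exact .of_steps fun reg _ => steps_const h.head
  | load e ih =>
    rw [compile] at h ⊢
    rw [eval]
    simpa only [List.length_append, List.length_singleton, ← add_assoc] using
      (ih hd h.left).load h.right.head
  | op o a b iha ihb =>
    rw [compile] at h ⊢
    have hop := h.right.head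
    simp only [List.length_append, List.length_singleton, ← add_assoc] at hop ⊢
    exact (iha hd h.left.left).op hd (ihb d.succ_pos h.left.right) hop
  | ite a b c e iha ihb ihc ihe =>
    rw [compile] at h ⊢
    have hA := h.left.left.left.left.left
    have hB := h.left.left.left.left.right
    have hbranch := h.left.left.left.right.head
    have hE := h.left.left.right
    have hjump := h.left.right.head
    have hC := h.right
    simp only [List.length_append, List.length_singleton, ← add_assoc] at hbranch hE hjump hC ⊢
    exact (iha hd hA).ite hd (ihb d.succ_pos hB) hbranch (ihe hd hE) hjump (ihc hd hC)

/-- The program that evaluates an expression and stops. -/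
def Expr.program (e : Expr) : Program := e.compile 1 0 ++ [.halt 1]

theorem Expr.answers_program {e : Expr} {T w : ℕ} {D : List Bool} {x : ℕ} {y : ℤ}
    (hT : e.program.length ≤ T)
    (h : e.eval (memOf w D) (BitVec.ofNat w x) = BitVec.ofInt w y) :
    Answers e.program T w D x y := by
  have hP : ContainsAt e.program 0 (e.compile 1 0 ++ [.halt 1]) := List.prefix_refl _
  obtain ⟨n, hn, reg, hs, hv, -⟩ := e.compile_delivers (mem := memOf w D) one_pos hP.left
    (Function.update (fun _ => 0) 0 (BitVec.ofNat w x)) (Function.update_self ..)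
  have hlen : e.program.length = (e.compile 1 0).length + 1 := by
    rw [program, List.length_append, List.length_singleton]
  refine run_mono (T := 1 + n) (by lia) ?_
  rw [hs 1, run, hP.right.head]
  simp only [hv, h]

/-! ### Bit strings -/

/-- The number whose binary digits, least significant first, are the `len` bits of `D` from
position `p` on; bits after the end of `D` are `0`. -/
def readBits (D : List Bool) (p len : ℕ) : ℕ :=
  Nat.ofBits fun i : Fin len => D.getD (p + i) false

theorem testBit_readBits (D : List Bool) (p len i : ℕ) :
    (readBits D p len).testBit i = (decide (i < len) && D.getD (p + i) false) := by
  rw [readBits, Nat.testBit_ofBits]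
  split_ifs with h <;> simp [h]

theorem readBits_mod_two_pow {D : List Bool} {p l len : ℕ} (h : l ≤ len) :
    readBits D p len % 2 ^ l = readBits D p l := by
  refine Nat.eq_of_testBit_eq fun i => ?_
  rw [Nat.testBit_mod_two_pow, testBit_readBits, testBit_readBits]
  by_cases hi : i < l
  · simp [hi, hi.trans_le h]
  · simp [hi]

theorem readBits_add_eq_or (D : List Bool) (p : ℕ) {r w : ℕ} (hr : r ≤ w) :
    readBits D (p + r) w =
      readBits D p w >>> r ||| (readBits D (p + w) w <<< (w - r)) % 2 ^ w := by
  refine Nat.eq_of_testBit_eq fun i => ?_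
  rw [Nat.testBit_or, Nat.testBit_shiftRight, Nat.testBit_mod_two_pow, Nat.testBit_shiftLeft]
  simp only [testBit_readBits]
  by_cases hi : i < w
  · by_cases hlow : r + i < w
    · simp [hi, hlow, show ¬ w - r ≤ i by lia, add_assoc]
    · simp [hi, hlow, show w - r ≤ i by lia, show i - (w - r) < w by lia,
        show p + w + (i - (w - r)) = p + r + i by lia]
  · simp [hi, show ¬ r + i < w by lia]

theorem ContainsAt.readBits_add {D Y : List Bool} {p q len : ℕ} (h : ContainsAt D p Y)
    (hq : q + len ≤ Y.length) : readBits D (p + q) len = readBits Y q len := by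
  refine Nat.eq_of_testBit_eq fun i => ?_
  rw [testBit_readBits, testBit_readBits]
  by_cases hi : i < len
  · simp only [List.getD_eq_getElem?_getD, add_assoc]
    rw [h.getElem? (by lia)]
  · simp [hi]

/-- The lowest `len` binary digits of `v`. -/
def toBits (len v : ℕ) : List Bool := (List.range len).map v.testBit

@[simp] theorem length_toBits (len v : ℕ) : (toBits len v).length = len := by simp [toBits]

theorem readBits_toBits {len v : ℕ} (hv : v < 2 ^ len) : readBits (toBits len v) 0 len = v := by
  refine Nat.eq_of_testBit_eq fun i => ?_
  rw [testBit_readBits]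
  by_cases hi : i < len
  · simp [hi, toBits]
  · have hvi : v.testBit i = false :=
      Nat.testBit_lt_two_pow (hv.trans_le (Nat.pow_le_pow_right two_pos (not_lt.mp hi)))
    simp [hi, hvi]

theorem ContainsAt.readBits_eq {D : List Bool} {p len v : ℕ} (h : ContainsAt D p (toBits len v))
    (hv : v < 2 ^ len) : readBits D p len = v := by
  simpa only [add_zero, readBits_toBits hv] using
    h.readBits_add (q := 0) (len := len) (by rw [zero_add, length_toBits])

/-- The concatenation of `g 0, …, g (K - 1)`. -/
def concat {α : Type*} (K : ℕ) (g : ℕ → List α) : List α := (List.range K).flatMap g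

section Concat

variable {α : Type*} (g : ℕ → List α)

theorem concat_succ (K : ℕ) : concat (K + 1) g = concat K g ++ g K := by
  simp [concat, List.range_succ]

theorem length_concat (K : ℕ) : (concat K g).length = ∑ i ∈ Finset.range K, (g i).length := by
  induction K with
  | zero => rfl
  | succ K ih => rw [concat_succ, List.length_append, ih, Finset.sum_range_succ]

theorem containsAt_concat {K i : ℕ} (hi : i < K) :
    ContainsAt (concat K g) (∑ j ∈ Finset.range i, (g j).length) (g i) := by
  induction K with
  | zero => exact absurd hi i.not_lt_zero
  | succ K ih =>
    rw [concat_succ]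
    rcases Nat.lt_succ_iff_lt_or_eq.mp hi with h | rfl
    · exact (ih h).append_right
    · rw [← length_concat]
      exact .length_append _ _

end Concat

/-- The array of the numbers `v 0, …, v (K - 1)` with `len` bits each. -/
def array (len K : ℕ) (v : ℕ → ℕ) : List Bool := concat K fun i => toBits len (v i)

@[simp] theorem length_array (len K : ℕ) (v : ℕ → ℕ) : (array len K v).length = K * len := by
  simp [array, length_concat]

theorem containsAt_array {len K i : ℕ} (v : ℕ → ℕ) (hi : i < K) :
    ContainsAt (array len K v) (i * len) (toBits len (v i)) := by
  simpa [array] using containsAt_concat (fun i => toBits len (v i)) hi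

/-- The number of `w`-bit words that a bit string occupies. -/
def wordCount (w : ℕ) (l : List Bool) : ℕ := l.length ⌈/⌉ w

theorem length_le_wordCount_mul {w : ℕ} (hw : 0 < w) (l : List Bool) :
    l.length ≤ wordCount w l * w := by
  simpa only [wordCount, smul_eq_mul, mul_comm] using le_smul_ceilDiv (b := l.length) hw

theorem wordCount_mul_le (w : ℕ) (l : List Bool) : wordCount w l * w ≤ l.length + w := by
  rw [wordCount, Nat.ceilDiv_eq_add_pred_div]
  exact (Nat.div_mul_le_self _ _).trans (Nat.sub_le _ _)

theorem length_div_le_wordCount (w : ℕ) (l : List Bool) : l.length / w ≤ wordCount w l := by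
  rw [wordCount, ← Nat.floorDiv_eq_div]
  exact floorDiv_le_ceilDiv

/-- A bit string filled up with zeros to whole words. -/
def pad (w : ℕ) (l : List Bool) : List Bool :=
  l ++ List.replicate (wordCount w l * w - l.length) false

theorem length_pad {w : ℕ} (hw : 0 < w) (l : List Bool) :
    (pad w l).length = wordCount w l * w := by
  rw [pad, List.length_append, List.length_replicate,
    Nat.add_sub_of_le (length_le_wordCount_mul hw l)]

theorem containsAt_pad (w : ℕ) (l : List Bool) : ContainsAt (pad w l) 0 l :=
  List.prefix_append _ _

theorem containsAt_concat_pad {w K i : ℕ} (hw : 0 < w) (g : ℕ → List Bool) (hi : i < K) :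
    ContainsAt (concat K fun j => pad w (g j))
      ((∑ j ∈ Finset.range i, wordCount w (g j)) * w) (g i) := by
  simpa [length_pad hw, Finset.sum_mul] using
    (containsAt_concat (fun j => pad w (g j)) hi).trans (containsAt_pad w (g i))

theorem length_concat_pad {w : ℕ} (hw : 0 < w) (K : ℕ) (g : ℕ → List Bool) :
    (concat K fun j => pad w (g j)).length = (∑ j ∈ Finset.range K, wordCount w (g j)) * w := by
  simp [length_concat, length_pad hw, Finset.sum_mul]

/-! ### Values of expressions -/

instance : Add Expr := ⟨.op .add⟩
instance : Sub Expr := ⟨.op .sub⟩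
instance : Mul Expr := ⟨.op .mul⟩
instance : Div Expr := ⟨.op .div⟩
instance : Mod Expr := ⟨.op .mod⟩

/-- With the bit string `D` in memory and the argument `x`, the expression `e` has the value `n`. -/
def HasValue (w : ℕ) (D : List Bool) (x : BitVec w) (e : Expr) (n : ℕ) : Prop :=
  (e.eval (memOf w D) x).toNat = n

section HasValue

variable {w : ℕ} {D : List Bool} {x : BitVec w} {e e' : Expr} {a b : ℕ}

theorem hasValue_arg {y : ℕ} (hy : y < 2 ^ w) : HasValue w D (BitVec.ofNat w y) .arg y := by
  rw [HasValue, Expr.eval, BitVec.toNat_ofNat, Nat.mod_eq_of_lt hy]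

theorem hasValue_const (h : a < 2 ^ w) : HasValue w D x (.const a) a := by
  rw [HasValue, Expr.eval, BitVec.toNat_ofNat, Nat.mod_eq_of_lt h]

namespace HasValue

theorem lt_two_pow (h : HasValue w D x e a) : a < 2 ^ w := h ▸ BitVec.isLt _

theorem eval_eq (h : HasValue w D x e a) : e.eval (memOf w D) x = BitVec.ofInt w a := by
  rw [BitVec.ofInt_natCast, ← h, BitVec.ofNat_toNat, BitVec.setWidth_eq]

theorem add (h : HasValue w D x e a) (h' : HasValue w D x e' b) (hab : a + b < 2 ^ w) :
    HasValue w D x (e + e') (a + b) := by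
  subst h h'
  exact Nat.mod_eq_of_lt hab

theorem mul (h : HasValue w D x e a) (h' : HasValue w D x e' b) (hab : a * b < 2 ^ w) :
    HasValue w D x (e * e') (a * b) := by
  subst h h'
  exact (BitVec.toNat_mul _ _).trans (Nat.mod_eq_of_lt hab)

theorem sub (h : HasValue w D x e a) (h' : HasValue w D x e' b) (hab : b ≤ a) :
    HasValue w D x (e - e') (a - b) := by
  subst h h'
  exact BitVec.toNat_sub_of_le hab

theorem div (h : HasValue w D x e a) (h' : HasValue w D x e' b) :
    HasValue w D x (e / e') (a / b) := by
  subst h h'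
  exact BitVec.toNat_udiv

theorem mod (h : HasValue w D x e a) (h' : HasValue w D x e' b) :
    HasValue w D x (e % e') (a % b) := by
  subst h h'
  exact BitVec.toNat_umod

theorem or (h : HasValue w D x e a) (h' : HasValue w D x e' b) :
    HasValue w D x (.op .or e e') (a ||| b) := by
  subst h h'
  exact BitVec.toNat_or _ _

theorem shr (h : HasValue w D x e a) (h' : HasValue w D x e' b) :
    HasValue w D x (.op .shr e e') (a >>> b) := by
  subst h h'
  exact BitVec.toNat_ushiftRight _ _

theorem shl (h : HasValue w D x e a) (h' : HasValue w D x e' b) :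
    HasValue w D x (.op .shl e e') (a <<< b % 2 ^ w) := by
  subst h h'
  exact BitVec.toNat_shiftLeft

theorem load (h : HasValue w D x e a) : HasValue w D x (.load e) (readBits D (a * w) w) := by
  subst h
  exact BitVec.toNat_ofFnLE _

theorem eval_ite_of_lt {c d : Expr} (h : HasValue w D x e a) (h' : HasValue w D x e' b)
    (hab : a < b) : (Expr.ite e e' c d).eval (memOf w D) x = c.eval (memOf w D) x := by
  subst h h'
  exact if_pos hab

theorem eval_ite_of_not_lt {c d : Expr} (h : HasValue w D x e a) (h' : HasValue w D x e' b)
    (hab : ¬ a < b) : (Expr.ite e e' c d).eval (memOf w D) x = d.eval (memOf w D) x := by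
  subst h h'
  exact if_neg hab

theorem ite_of_lt {c d : Expr} {n : ℕ} (h : HasValue w D x e a) (h' : HasValue w D x e' b)
    (hab : a < b) (hn : HasValue w D x c n) : HasValue w D x (.ite e e' c d) n :=
  (congrArg BitVec.toNat (h.eval_ite_of_lt h' hab)).trans hn

theorem ite_of_not_lt {c d : Expr} {n : ℕ} (h : HasValue w D x e a) (h' : HasValue w D x e' b)
    (hab : ¬ a < b) (hn : HasValue w D x d n) : HasValue w D x (.ite e e' c d) n :=
  (congrArg BitVec.toNat (h.eval_ite_of_not_lt h' hab)).trans hn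

end HasValue

/-- The number `-1`, a word of ones. -/
def Expr.negOne : Expr := .const 0 - .const 1

theorem eval_negOne : Expr.negOne.eval (memOf w D) x = BitVec.ofInt w (-1) := by
  change BitVec.ofNat w 0 - BitVec.ofNat w 1 = BitVec.ofInt w (-1)
  rw [BitVec.ofInt_neg]
  simp

/-- The power `2 ^ e`. -/
def Expr.twoPow (e : Expr) : Expr := .op .shl (.const 1) e

theorem HasValue.twoPow (h : HasValue w D x e a) (ha : a < w) :
    HasValue w D x e.twoPow (2 ^ a) := by
  have hshl := (hasValue_const (Nat.one_lt_two_pow (by lia))).shl h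
  rwa [Nat.shiftLeft_eq, one_mul, Nat.mod_eq_of_lt (Nat.pow_lt_pow_right one_lt_two ha)] at hshl

/-- The word size, which is stored in memory word `1`. -/
def Expr.wordSize : Expr := .load (.const 1)

/-- The number in the `len` bits from position `p` on, counted from the beginning of the word with
address `base`; the bits may extend over two words. -/
def Expr.readBits (base p len : Expr) : Expr :=
  .op .or (.op .shr (.load (base + p / wordSize)) (p % wordSize))
    (.op .shl (.load (base + p / wordSize + .const 1)) (wordSize - p % wordSize)) % len.twoPow

theorem HasValue.readBits {base p len : Expr} {q l : ℕ} (hw : HasValue w D x .wordSize w)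
    (ha : HasValue w D x base a) (hp : HasValue w D x p q) (hl : HasValue w D x len l) (hlw : l < w)
    (hq : a + q / w + 1 < 2 ^ w) :
    HasValue w D x (.readBits base p len) (FID.readBits D (a * w + q) l) := by
  have hr : q % w ≤ w := (q.mod_lt (by lia)).le
  have hword := ha.add (hp.div hw) (by lia)
  have hnext := hword.add (hasValue_const (a := 1) (by lia)) hq
  have hlow := hword.load.shr (hp.mod hw)
  have hhigh := hnext.load.shl (hw.sub (hp.mod hw) hr)
  have hpos : (a + q / w) * w + q % w = a * w + q := by rw [add_mul, add_assoc, Nat.div_add_mod']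
  have hor := hlow.or hhigh
  rw [add_one_mul, ← readBits_add_eq_or D _ hr, hpos] at hor
  have hmod := hor.mod (hl.twoPow hlw)
  rwa [readBits_mod_two_pow hlw.le] at hmod

end HasValue

/-! ### Sections of the memory -/

/-- The relations between the word size `w`, the block length `t` and the length `f` of short
fields that the data structure needs: `f` bits hold every number below `t ^ 4`. -/
structure Admissible (w t f : ℕ) : Prop where
  blockLength_le : 8 * t ≤ w
  le_blockLength : 100 ≤ t
  fieldLength_le : f ≤ t
  blockLength_pow_le : t ^ 4 ≤ 2 ^ f

/-- The block length, which is stored in memory word `2`. -/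
def Expr.blockLength : Expr := .load (.const 2)

/-- The length of short fields, which is stored in memory word `3`. -/
def Expr.fieldLength : Expr := .load (.const 3)

/-- The address of section `k`, which is stored in memory word `4 + k`. -/
def Expr.sectionStart (k : ℕ) : Expr := .load (.const (4 + k))

/-- The memory words `1`, `2` and `3` hold the word size, the block length and the length of short
fields. -/
structure HasParameters (w t f : ℕ) (D : List Bool) : Prop extends Admissible w t f where
  readBits_wordSize : readBits D (1 * w) w = w
  readBits_blockLength : readBits D (2 * w) w = t
  readBits_fieldLength : readBits D (3 * w) w = f

/-- The address of section `k`, as stored in the memory. -/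
def sectionStart (w : ℕ) (D : List Bool) (k : ℕ) : ℕ := readBits D ((4 + k) * w) w

/-- The bit string `Y` is stored from word `a` of the memory `D` on. -/
structure StoredAt (w : ℕ) (D : List Bool) (a : ℕ) (Y : List Bool) : Prop where
  containsAt : ContainsAt D (a * w) Y
  end_lt : a + Y.length / w + 1 < 2 ^ w

/-- Section `k` of the memory begins with the bit string `Y`. -/
structure HasSection (w : ℕ) (D : List Bool) (k : ℕ) (Y : List Bool) : Prop where
  index_lt : k < 60
  storedAt : StoredAt w D (sectionStart w D k) Y

namespace Admissible

variable {w t f : ℕ}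

theorem blockLength_pos (h : Admissible w t f) : 0 < t := by have := h.le_blockLength; lia

theorem fieldLength_lt (h : Admissible w t f) : f < w := by
  have := h.blockLength_le; have := h.le_blockLength; have := h.fieldLength_le; lia

theorem wordSize_pos (h : Admissible w t f) : 0 < w := f.zero_le.trans_lt h.fieldLength_lt

theorem lt_two_pow_of_lt (h : Admissible w t f) {k : ℕ} (hk : k < 64) : k < 2 ^ w :=
  have := h.blockLength_le
  have := h.le_blockLength
  calc k < 2 ^ 6 := hk
    _ ≤ 2 ^ w := Nat.pow_le_pow_right two_pos (by lia)

theorem blockLength_mul_lt (h : Admissible w t f) : t * t < 2 ^ f := by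
  have := h.le_blockLength
  calc t * t = t ^ 2 := (sq t).symm
    _ < t ^ 4 := Nat.pow_lt_pow_right (by lia) (by norm_num)
    _ ≤ 2 ^ f := h.blockLength_pow_le

end Admissible

namespace HasParameters

variable {w t f k I K : ℕ} {D : List Bool} {x : BitVec w} {v : ℕ → ℕ} {i : Expr}

theorem wordSize (h : HasParameters w t f D) : HasValue w D x .wordSize w := by
  have hload := (hasValue_const (D := D) (x := x) (h.lt_two_pow_of_lt (k := 1) (by norm_num))).load
  rwa [h.readBits_wordSize] at hload

theorem blockLength (h : HasParameters w t f D) : HasValue w D x .blockLength t := by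
  have hload := (hasValue_const (D := D) (x := x) (h.lt_two_pow_of_lt (k := 2) (by norm_num))).load
  rwa [h.readBits_blockLength] at hload

theorem fieldLength (h : HasParameters w t f D) : HasValue w D x .fieldLength f := by
  have hload := (hasValue_const (D := D) (x := x) (h.lt_two_pow_of_lt (k := 3) (by norm_num))).load
  rwa [h.readBits_fieldLength] at hload

theorem sectionStart (h : HasParameters w t f D) (hk : k < 60) :
    HasValue w D x (.sectionStart k) (FID.sectionStart w D k) :=
  (hasValue_const (h.lt_two_pow_of_lt (k := 4 + k) (by lia))).load

end HasParameters

namespace StoredAt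

variable {w a I K : ℕ} {D : List Bool} {x : BitVec w} {base i : Expr}

theorem word {v : ℕ → ℕ} (h : StoredAt w D a (array w K v)) (hw : 0 < w)
    (ha : HasValue w D x base a) (hi : HasValue w D x i I) (hI : I < K) (hv : v I < 2 ^ w) :
    HasValue w D x (.load (base + i)) (v I) := by
  have hend := h.end_lt
  rw [length_array, Nat.mul_div_cancel _ hw] at hend
  have hcontains := h.containsAt.trans (containsAt_array v hI)
  rw [← add_mul] at hcontains
  simpa only [hcontains.readBits_eq hv] using (ha.add hi (by lia)).load

theorem add_div_lt {Y : List Bool} (h : StoredAt w D a Y) {q : ℕ} (hq : q ≤ Y.length) :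
    a + q / w + 1 < 2 ^ w := by
  have := h.end_lt
  have : q / w ≤ Y.length / w := Nat.div_le_div_right hq
  lia

theorem bits {Y : List Bool} (h : StoredAt w D a Y) (hw : HasValue w D x .wordSize w)
    (ha : HasValue w D x base a) {p len : Expr} {q l u : ℕ} (hq : HasValue w D x p q)
    (hl : HasValue w D x len l) (hlw : l < w) (hY : ContainsAt Y q (toBits l u))
    (hqY : q ≤ Y.length) (hu : u < 2 ^ l) : HasValue w D x (.readBits base p len) u := by
  have hread := hw.readBits ha hq hl hlw (h.add_div_lt hqY)
  rwa [(h.containsAt.trans hY).readBits_eq hu] at hread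

theorem of_concat_pad {g : ℕ → List Bool} (h : StoredAt w D a (concat K fun j => pad w (g j)))
    (hw : 0 < w) (hI : I < K) :
    StoredAt w D (a + ∑ j ∈ Finset.range I, wordCount w (g j)) (g I) where
  containsAt := by
    rw [add_mul]
    exact h.containsAt.trans (containsAt_concat_pad hw g hI)
  end_lt := by
    have hend := h.end_lt
    rw [length_concat_pad hw, Nat.mul_div_cancel _ hw] at hend
    have hdiv := length_div_le_wordCount w (g I)
    have hsum : ∑ j ∈ Finset.range (I + 1), wordCount w (g j) ≤
        ∑ j ∈ Finset.range K, wordCount w (g j) :=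
      Finset.sum_le_sum_of_subset (Finset.range_mono hI)
    rw [Finset.sum_range_succ] at hsum
    lia

end StoredAt

/-- Entry `i` of the array of words in section `k`. -/
def Expr.word (k : ℕ) (i : Expr) : Expr := .load (sectionStart k + i)

/-- Entry `i` of the array of short fields in section `k`. -/
def Expr.field (k : ℕ) (i : Expr) : Expr :=
  readBits (sectionStart k) (i * fieldLength) fieldLength

namespace HasParameters

variable {w t f k I K : ℕ} {D : List Bool} {x : BitVec w} {v : ℕ → ℕ} {i : Expr}

theorem word (hp : HasParameters w t f D) (hk : HasSection w D k (array w K v))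
    (hi : HasValue w D x i I) (hI : I < K) (hv : v I < 2 ^ w) :
    HasValue w D x (.word k i) (v I) :=
  hk.storedAt.word hp.wordSize_pos (hp.sectionStart hk.index_lt) hi hI hv

theorem field (hp : HasParameters w t f D) (hk : HasSection w D k (array f K v))
    (hi : HasValue w D x i I) (hI : I < K) (hv : v I < 2 ^ f) (hIf : I * f < 2 ^ w) :
    HasValue w D x (.field k i) (v I) := by
  refine hk.storedAt.bits hp.wordSize (hp.sectionStart hk.index_lt) (hi.mul hp.fieldLength hIf)
    hp.fieldLength hp.fieldLength_lt (containsAt_array v hI) ?_ hv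
  rw [length_array]
  exact Nat.mul_le_mul_right _ hI.le

end HasParameters

/-! ### Decoding tables -/

theorem mul_add_lt_mul {a b m n : ℕ} (ha : a < m) (hb : b < n) : a * n + b < m * n :=
  calc a * n + b < (a + 1) * n := by lia
    _ ≤ m * n := Nat.mul_le_mul_right n ha

theorem mul_add_div_of_lt {a b n : ℕ} (h : b < n) : (a * n + b) / n = a := by
  rw [mul_comm, Nat.mul_add_div (by lia), Nat.div_eq_of_lt h, add_zero]

/-- The table of the numbers `F c v i` for a class `c < K`, a code `v` in this class and an index
`i < t`. Codes in class `c` have `len c ≤ B` bits, but the table is indexed by the `B` bits that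
are found from the beginning of the code on. -/
def decodingTable (w t B K : ℕ) (len : ℕ → ℕ) (F : ℕ → ℕ → ℕ → ℕ) : List Bool :=
  array w (K * 2 ^ B * t) fun n =>
    F (n / t / 2 ^ B) (n / t % 2 ^ B % 2 ^ len (n / t / 2 ^ B)) (n % t)

/-- Entry `i` of the decoding table in section `k` for the class `c` and the code at position `p`
after the word with address `base`. -/
def Expr.decode (k : ℕ) (width base c p i : Expr) : Expr :=
  word k ((c * width.twoPow + readBits base p width) * blockLength + i)

theorem HasParameters.decode {w t f k B K a c q v s : ℕ} {D Y : List Bool} {x : BitVec w}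
    {len : ℕ → ℕ} {F : ℕ → ℕ → ℕ → ℕ} {width base cls p i : Expr} (hp : HasParameters w t f D)
    (hk : HasSection w D k (decodingTable w t B K len F)) (hB : HasValue w D x width B)
    (hBw : B < w) (ha : HasValue w D x base a) (hY : StoredAt w D a Y)
    (hc : HasValue w D x cls c) (hcK : c < K) (hq : HasValue w D x p q)
    (hv : ContainsAt Y q (toBits (len c) v)) (hvlt : v < 2 ^ len c) (hlen : len c ≤ B)
    (hqY : q ≤ Y.length) (hi : HasValue w D x i s) (hs : s < t) (hF : F c v s < 2 ^ w) :
    HasValue w D x (.decode k width base cls p i) (F c v s) := by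
  have hread := hp.wordSize.readBits ha hq hB hBw (hY.add_div_lt hqY)
  have hcode := readBits_mod_two_pow (D := D) (p := a * w + q) hlen
  rw [(hY.containsAt.trans hv).readBits_eq hvlt] at hcode
  set X := FID.readBits D (a * w + q) B
  have hXlt : X < 2 ^ B := Nat.ofBits_lt_two_pow _
  have hindex : (c * 2 ^ B + X) * t + s < K * 2 ^ B * t :=
    mul_add_lt_mul (mul_add_lt_mul hcK hXlt) hs
  have hend := hk.storedAt.end_lt
  rw [decodingTable, length_array, Nat.mul_div_cancel _ hp.wordSize_pos] at hend
  have hle : c * 2 ^ B + X ≤ (c * 2 ^ B + X) * t := Nat.le_mul_of_pos_right _ hp.blockLength_pos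
  have hn := (((hc.mul (hB.twoPow hBw) (by lia)).add hread (by lia)).mul hp.blockLength
    (by lia)).add hi (by lia)
  have hentry := hp.word hk hn hindex
  simp only [mul_add_div_of_lt hs, mul_add_div_of_lt hXlt, Nat.mul_add_mod_of_lt hs,
    Nat.mul_add_mod_of_lt hXlt, hcode] at hentry
  exact hentry hF

/-! ### Sequences with small increments -/

/-- Entry `i` of a sequence with small increments: every `t`-th entry is a word in section `k`,
the differences to these entries are fields in section `k'`. -/
def Expr.sampled (k k' : ℕ) (i : Expr) : Expr := word k (i / blockLength) + field k' i

/-- The samples of a sequence, namely every `t`-th entry. -/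
def samples (w t M : ℕ) (v : ℕ → ℕ) : List Bool := array w (M / t + 1) fun g => v (g * t)

/-- The differences between the entries of a sequence and the preceding samples. -/
def sampleOffsets (t f M : ℕ) (v : ℕ → ℕ) : List Bool := array f M fun b => v b - v (b / t * t)

theorem apply_add_le_of_succ_le {v : ℕ → ℕ} {t : ℕ} (hv : ∀ b, v (b + 1) ≤ v b + t) (b c : ℕ) :
    v (b + c) ≤ v b + c * t := by
  induction c with
  | zero => simp
  | succ c ih => exact (hv (b + c)).trans (by lia)

theorem HasParameters.sampled {w t f k k' M I : ℕ} {D : List Bool} {x : BitVec w} {v : ℕ → ℕ}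
    {i : Expr} (hp : HasParameters w t f D) (hk : HasSection w D k (samples w t M v))
    (hk' : HasSection w D k' (sampleOffsets t f M v)) (hmono : Monotone v)
    (hstep : ∀ b, v (b + 1) ≤ v b + t) (hi : HasValue w D x i I) (hI : I < M) (hv : v I < 2 ^ w)
    (hIf : I * f < 2 ^ w) : HasValue w D x (.sampled k k' i) (v I) := by
  have hle : v (I / t * t) ≤ v I := hmono (Nat.div_mul_le_self I t)
  have hoffset : v I - v (I / t * t) < 2 ^ f := by
    have hinc := apply_add_le_of_succ_le hstep (I / t * t) (I % t)
    rw [Nat.div_add_mod'] at hinc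
    have hmod : I % t * t ≤ t * t := Nat.mul_le_mul_right _ (Nat.mod_lt _ hp.blockLength_pos).le
    have := hp.blockLength_mul_lt
    lia
  have hword := hp.word hk (hi.div hp.blockLength) (Nat.lt_succ_of_le (Nat.div_le_div_right hI.le))
    (hle.trans_lt hv)
  have hsum := hword.add (hp.field hk' hi hI hoffset hIf) (by rwa [Nat.add_sub_cancel' hle])
  rwa [Nat.add_sub_cancel' hle] at hsum

/-! ### Codes of monotone sequences -/

section Encode

variable {α : Type*} [DecidableEq α] {F : Finset α} {a : α}

/-- The number of an element in a numbering of the finite set `F`. -/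
noncomputable def encode (F : Finset α) (a : α) : ℕ := if h : a ∈ F then F.equivFin ⟨a, h⟩ else 0

/-- The element of `F` with a given number. -/
noncomputable def decode {α : Type*} [Inhabited α] (F : Finset α) (n : ℕ) : α :=
  if h : n < F.card then F.equivFin.symm ⟨n, h⟩ else default

theorem encode_lt (h : a ∈ F) : encode F a < F.card := by simp [encode, h]

theorem decode_encode [Inhabited α] (h : a ∈ F) : decode F (encode F a) = a := by
  rw [decode, dif_pos (encode_lt h)]
  simp [encode, h]

end Encode

/-- The monotone sequences of length `t` with values at most `s`. -/
def monotoneSeqs (t s : ℕ) : Finset (Fin t → Fin (s + 1)) :=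
  open Classical in {d | Monotone d}

theorem card_monotoneSeqs_le_choose (t s : ℕ) : (monotoneSeqs t s).card ≤ (t + s).choose s := by
  have hcard : Fintype.card (Sym (Fin (s + 1)) t) = (t + s).choose s := by
    rw [Sym.card_sym_eq_multichoose, Fintype.card_fin, Nat.multichoose_eq,
      show s + 1 + t - 1 = t + s by lia, Nat.choose_symm_add]
  rw [← hcard, ← Finset.card_univ]
  refine Finset.card_le_card_of_injOn (fun d => ⟨List.ofFn d, by simp⟩)
    (fun _ _ => Finset.mem_coe.mpr (Finset.mem_univ _)) ?_
  intro d hd d' hd' h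
  have hd : Monotone d := by simpa [monotoneSeqs] using hd
  have hd' : Monotone d' := by simpa [monotoneSeqs] using hd'
  have hperm : (List.ofFn d).Perm (List.ofFn d') := Multiset.coe_eq_coe.mp (congrArg Subtype.val h)
  exact List.ofFn_injective
    (hperm.eq_of_sortedLE (List.sortedLE_ofFn_iff.mpr hd) (List.sortedLE_ofFn_iff.mpr hd'))

theorem choose_add_le_pow (t s : ℕ) : (t + s).choose s ≤ (t + 1) ^ s := by
  induction s with
  | zero => simp
  | succ s ih =>
    refine Nat.le_of_mul_le_mul_right ?_ s.succ_pos
    calc (t + (s + 1)).choose (s + 1) * (s + 1) = (t + s + 1) * (t + s).choose s :=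
          (Nat.add_one_mul_choose_eq _ _).symm
      _ ≤ (t + 1) * (s + 1) * (t + 1) ^ s := Nat.mul_le_mul (by lia) ih
      _ = (t + 1) ^ (s + 1) * (s + 1) := by ring

/-- The number of bits of the code of a monotone sequence of length `t` with values at most `s`,
where `t + 1 ≤ 2 ^ f`. -/
def monotoneCodeLength (t f s : ℕ) : ℕ := min (s * f) (t + s)

/-- The code of the first `t` terms of a monotone sequence with values at most `s`. -/
noncomputable def monotoneCode (t s : ℕ) (d : ℕ → ℕ) : ℕ :=
  encode (monotoneSeqs t s) fun i => Fin.ofNat (s + 1) (d i)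

/-- Term `i` of the monotone sequence with code `n`. -/
noncomputable def monotoneDecode (t s n i : ℕ) : ℕ :=
  if h : i < t then decode (monotoneSeqs t s) n ⟨i, h⟩ else 0

section MonotoneCode

variable {t f s : ℕ} {d : ℕ → ℕ}

theorem mem_monotoneSeqs (hd : Monotone d) (hs : ∀ i < t, d i ≤ s) :
    (fun i : Fin t => Fin.ofNat (s + 1) (d i)) ∈ monotoneSeqs t s := by
  simp only [monotoneSeqs, Finset.mem_filter, Finset.mem_univ, true_and]
  intro i j hij
  simp only [Fin.le_def, Fin.ofNat, Nat.mod_eq_of_lt (Nat.lt_succ_of_le (hs _ (Fin.is_lt _)))]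
  exact hd hij

theorem monotoneCode_lt (hd : Monotone d) (hs : ∀ i < t, d i ≤ s) (ht : t + 1 ≤ 2 ^ f) :
    monotoneCode t s d < 2 ^ monotoneCodeLength t f s := by
  refine (encode_lt (mem_monotoneSeqs hd hs)).trans_le ((card_monotoneSeqs_le_choose t s).trans ?_)
  rcases min_choice (s * f) (t + s) with h | h <;> rw [monotoneCodeLength, h]
  · calc (t + s).choose s ≤ (t + 1) ^ s := choose_add_le_pow t s
      _ ≤ (2 ^ f) ^ s := Nat.pow_le_pow_left ht s
      _ = 2 ^ (s * f) := by rw [mul_comm, pow_mul]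
  · exact Nat.choose_le_two_pow _ _

theorem monotoneDecode_monotoneCode (hd : Monotone d) (hs : ∀ i < t, d i ≤ s) {i : ℕ}
    (hi : i < t) : monotoneDecode t s (monotoneCode t s d) i = d i := by
  rw [monotoneDecode, dif_pos hi, monotoneCode, decode_encode (mem_monotoneSeqs hd hs)]
  exact Nat.mod_eq_of_lt (Nat.lt_succ_of_le (hs i hi))

end MonotoneCode

/-! ### Storage of a monotone sequence -/

section Monotone

variable (w t f : ℕ) (β : ℕ → ℕ)

/-- Value `s` of subgroup `J`, relative to the first value of the subgroup. Subgroups consist of `t`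
values and groups of `t` subgroups. -/
def subgroupValue (J s : ℕ) : ℕ := β (J * t + s) - β (J * t)

/-- The increase of `β` over subgroup `J`. -/
def subgroupSpan (J : ℕ) : ℕ := β ((J + 1) * t) - β (J * t)

/-- The storage of a subgroup: a code if its span is small, and its relative values otherwise. -/
noncomputable def subgroupBits (J : ℕ) : List Bool :=
  if subgroupSpan t β J < t then
    toBits (monotoneCodeLength t f (subgroupSpan t β J))
      (monotoneCode t (subgroupSpan t β J) (subgroupValue t β J))
  else array f t (subgroupValue t β J)

/-- The increase of `β` over group `g`. -/
def groupSpan (g : ℕ) : ℕ := β ((g + 1) * t * t) - β (g * t * t)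

/-- The first value of subgroup `j` of group `g`, relative to the first value of the group. -/
def subgroupOffset (g j : ℕ) : ℕ := β ((g * t + j) * t) - β (g * t * t)

/-- The position of subgroup `j` in the storage of the dense group `g`. -/
noncomputable def subgroupPosition (g j : ℕ) : ℕ :=
  3 * t * f + ∑ i ∈ Finset.range j, (subgroupBits t f β (g * t + i)).length

/-- The storage of a dense group: a directory, which consists of the offsets, the positions and the
spans of its subgroups, and the subgroups themselves. -/
noncomputable def denseBits (g : ℕ) : List Bool :=
  array f t (subgroupOffset t β g) ++ array f t (subgroupPosition t f β g) ++
    array f t (fun j => subgroupSpan t β (g * t + j)) ++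
    concat t fun j => subgroupBits t f β (g * t + j)

/-- The storage of a group: a word for each value if the span is large. -/
noncomputable def groupBits (g : ℕ) : List Bool :=
  if t ^ 3 ≤ groupSpan t β g then array w (t * t) fun i => β (g * t * t + i)
  else denseBits t f β g

/-- The first values of the groups. -/
def groupFirsts (G : ℕ) : List Bool := array w G fun g => β (g * t * t)

/-- The flags of the groups: `1` for a group with a word for each value. -/
def groupFlags (G : ℕ) : List Bool := array w G fun g => if t ^ 3 ≤ groupSpan t β g then 1 else 0

/-- The numbers of words before the groups in `groupData`. -/
noncomputable def groupPointers (G : ℕ) : List Bool :=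
  array w G fun g => ∑ i ∈ Finset.range g, wordCount w (groupBits w t f β i)

/-- The storage of all groups. -/
noncomputable def groupData (G : ℕ) : List Bool := concat G fun g => pad w (groupBits w t f β g)

/-- The decoding table for the subgroups of small span. -/
noncomputable def monotoneTable : List Bool :=
  decodingTable w t (t + t) t (monotoneCodeLength t f) (monotoneDecode t)

/-- Sections `k, …, k + 4` store the first `G` groups of the sequence `β`. -/
structure HasMonotone (D : List Bool) (k G : ℕ) : Prop where
  firsts : HasSection w D k (groupFirsts w t β G)
  flags : HasSection w D (k + 1) (groupFlags w t β G)
  pointers : HasSection w D (k + 2) (groupPointers w t f β G)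
  data : HasSection w D (k + 3) (groupData w t f β G)
  table : HasSection w D (k + 4) (monotoneTable w t f)

end Monotone

section Lengths

variable {w t f : ℕ} {β : ℕ → ℕ}

theorem length_subgroupBits_le_span_mul (t f : ℕ) (β : ℕ → ℕ) (J : ℕ) :
    (subgroupBits t f β J).length ≤ subgroupSpan t β J * f := by
  rw [subgroupBits]
  split_ifs with h
  · rw [length_toBits]
    exact min_le_left _ _
  · rw [length_array]
    exact Nat.mul_le_mul_right _ (not_lt.mp h)

theorem length_subgroupBits_le (t f : ℕ) (β : ℕ → ℕ) (J : ℕ) :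
    (subgroupBits t f β J).length ≤ t * f := by
  by_cases h : subgroupSpan t β J < t
  · exact (length_subgroupBits_le_span_mul t f β J).trans (Nat.mul_le_mul_right _ h.le)
  · rw [subgroupBits, if_neg h, length_array]

theorem subgroupPosition_le (t f : ℕ) (β : ℕ → ℕ) (g j : ℕ) :
    subgroupPosition t f β g j ≤ 3 * t * f + j * (t * f) := by
  have hsum := Finset.sum_le_card_nsmul (Finset.range j)
    (fun i => (subgroupBits t f β (g * t + i)).length) _ fun _ _ => length_subgroupBits_le t f β _
  rw [Finset.card_range, smul_eq_mul] at hsum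
  exact Nat.add_le_add_left hsum _

theorem length_denseBits (t f : ℕ) (β : ℕ → ℕ) (g : ℕ) :
    (denseBits t f β g).length = subgroupPosition t f β g t := by
  simp only [denseBits, List.length_append, length_array, length_concat, subgroupPosition]
  ring

theorem sum_subgroupSpan (hβ : Monotone β) (g n : ℕ) :
    ∑ j ∈ Finset.range n, subgroupSpan t β (g * t + j) = subgroupOffset t β g n :=
  Finset.sum_range_tsub (f := fun j => β ((g * t + j) * t))
    (fun _ _ h => hβ (Nat.mul_le_mul_right _ (Nat.add_le_add_left h _))) n

theorem subgroupOffset_le_groupSpan (hβ : Monotone β) (g : ℕ) {j : ℕ} (hj : j ≤ t) :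
    subgroupOffset t β g j ≤ groupSpan t β g := by
  refine Nat.sub_le_sub_right (hβ (Nat.mul_le_mul_right _ ?_)) _
  rw [add_one_mul]
  exact Nat.add_le_add_left hj _

theorem subgroupSpan_le_groupSpan (hβ : Monotone β) (g : ℕ) {j : ℕ} (hj : j < t) :
    subgroupSpan t β (g * t + j) ≤ groupSpan t β g :=
  calc subgroupSpan t β (g * t + j)
      ≤ ∑ i ∈ Finset.range t, subgroupSpan t β (g * t + i) :=
        Finset.single_le_sum_of_canonicallyOrdered
          (f := fun i => subgroupSpan t β (g * t + i)) (Finset.mem_range.mpr hj)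
    _ = subgroupOffset t β g t := sum_subgroupSpan hβ g t
    _ ≤ groupSpan t β g := subgroupOffset_le_groupSpan hβ g le_rfl

theorem length_denseBits_le (hβ : Monotone β) (f g : ℕ) :
    (denseBits t f β g).length ≤ 3 * t * f + groupSpan t β g * f := by
  rw [length_denseBits, subgroupPosition]
  refine Nat.add_le_add_left ?_ _
  calc ∑ i ∈ Finset.range t, (subgroupBits t f β (g * t + i)).length
      ≤ ∑ i ∈ Finset.range t, subgroupSpan t β (g * t + i) * f :=
        Finset.sum_le_sum fun i _ => length_subgroupBits_le_span_mul t f β _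
    _ = subgroupOffset t β g t * f := by rw [← Finset.sum_mul, sum_subgroupSpan hβ]
    _ ≤ groupSpan t β g * f := Nat.mul_le_mul_right _ (subgroupOffset_le_groupSpan hβ g le_rfl)

theorem mul_length_groupBits_le (hβ : Monotone β) (w f g : ℕ) :
    t * (groupBits w t f β g).length ≤
      t * (3 * t * f + groupSpan t β g * f) + groupSpan t β g * w := by
  rw [groupBits]
  split_ifs with h
  · rw [length_array, show t * (t * t * w) = t ^ 3 * w by ring]
    exact (Nat.mul_le_mul_right w h).trans (Nat.le_add_left _ _)
  · exact (Nat.mul_le_mul_left t (length_denseBits_le hβ f g)).trans (Nat.le_add_right _ _)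

theorem mul_length_groupData_le (hβ : Monotone β) (hw : 0 < w) (f : ℕ) {M : ℕ}
    (hM : ∀ i, β i ≤ M) (G : ℕ) :
    t * (groupData w t f β G).length ≤ G * (t * (3 * t * f + w)) + M * (t * f + w) := by
  have hgroup (g : ℕ) : t * (wordCount w (groupBits w t f β g) * w) ≤
      t * (3 * t * f + w) + groupSpan t β g * (t * f + w) := by
    have hwords := Nat.mul_le_mul_left t (wordCount_mul_le w (groupBits w t f β g))
    have := mul_length_groupBits_le (t := t) hβ w f g
    nlinarith
  have hsum : ∑ g ∈ Finset.range G, groupSpan t β g ≤ M := by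
    have htsub := Finset.sum_range_tsub (f := fun g => β (g * t * t))
      (fun _ _ h => hβ (Nat.mul_le_mul_right _ (Nat.mul_le_mul_right _ h))) G
    exact htsub.le.trans ((Nat.sub_le _ _).trans (hM _))
  rw [groupData, length_concat_pad hw, Finset.sum_mul, Finset.mul_sum]
  calc ∑ g ∈ Finset.range G, t * (wordCount w (groupBits w t f β g) * w)
      ≤ ∑ g ∈ Finset.range G, (t * (3 * t * f + w) + groupSpan t β g * (t * f + w)) :=
        Finset.sum_le_sum fun g _ => hgroup g
    _ = G * (t * (3 * t * f + w)) + (∑ g ∈ Finset.range G, groupSpan t β g) * (t * f + w) := by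
        rw [Finset.sum_add_distrib, Finset.sum_const, Finset.card_range, smul_eq_mul,
          ← Finset.sum_mul]
    _ ≤ G * (t * (3 * t * f + w)) + M * (t * f + w) :=
        Nat.add_le_add_left (Nat.mul_le_mul_right _ hsum) _

end Lengths

section DenseGroup

variable {t : ℕ} (f : ℕ) (β : ℕ → ℕ) (g : ℕ) {j : ℕ}

theorem containsAt_denseBits_offset (hj : j < t) :
    ContainsAt (denseBits t f β g) (j * f) (toBits f (subgroupOffset t β g j)) :=
  (containsAt_array _ hj).append_right.append_right.append_right

theorem containsAt_denseBits_position (hj : j < t) :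
    ContainsAt (denseBits t f β g) ((t + j) * f) (toBits f (subgroupPosition t f β g j)) := by
  have h := (ContainsAt.length_append (array f t (subgroupOffset t β g)) _).trans
    (containsAt_array (len := f) (subgroupPosition t f β g) hj)
  rw [length_array, ← add_mul] at h
  exact h.append_right.append_right

theorem containsAt_denseBits_span (hj : j < t) :
    ContainsAt (denseBits t f β g) ((t + t + j) * f) (toBits f (subgroupSpan t β (g * t + j))) := by
  have h := (ContainsAt.length_append
      (array f t (subgroupOffset t β g) ++ array f t (subgroupPosition t f β g)) _).trans
    (containsAt_array (len := f) (fun j => subgroupSpan t β (g * t + j)) hj)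
  rw [List.length_append, length_array, length_array, ← add_mul, ← add_mul] at h
  exact h.append_right

theorem containsAt_denseBits_subgroup (hj : j < t) :
    ContainsAt (denseBits t f β g) (subgroupPosition t f β g j)
      (subgroupBits t f β (g * t + j)) := by
  have h : ContainsAt (denseBits t f β g) _ (subgroupBits t f β (g * t + j)) :=
    (ContainsAt.length_append _ _).trans
      (containsAt_concat (fun j => subgroupBits t f β (g * t + j)) hj)
  simp only [List.length_append, length_array] at h
  rwa [subgroupPosition, show 3 * t * f = t * f + t * f + t * f by ring]

theorem subgroupPosition_add_le (hj : j < t) :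
    subgroupPosition t f β g j + (subgroupBits t f β (g * t + j)).length ≤
      (denseBits t f β g).length := by
  rw [length_denseBits, subgroupPosition, add_assoc, ← Finset.sum_range_succ
    fun i => (subgroupBits t f β (g * t + i)).length]
  exact Nat.add_le_add_left (Finset.sum_le_sum_of_subset (Finset.range_mono hj)) _

end DenseGroup

section DenseGroupBounds

variable {w t f g j : ℕ} {β : ℕ → ℕ}

theorem Admissible.blockLength_succ_le (h : Admissible w t f) : t + 1 ≤ 2 ^ f :=
  (Nat.le_mul_self t).trans_lt h.blockLength_mul_lt

theorem Admissible.subgroupPosition_lt (h : Admissible w t f) (hj : j < t) :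
    subgroupPosition t f β g j < 2 ^ f := by
  have hf := h.fieldLength_le
  have ht := h.le_blockLength
  calc subgroupPosition t f β g j ≤ 3 * t * f + j * (t * f) := subgroupPosition_le t f β g j
    _ ≤ 3 * t * t + t * (t * t) := by gcongr
    _ = (3 + t) * (t * t) := by ring
    _ < t * t * (t * t) := Nat.mul_lt_mul_of_pos_right (by nlinarith) (by positivity)
    _ = t ^ 4 := by ring
    _ ≤ 2 ^ f := h.blockLength_pow_le

theorem Admissible.lt_two_pow_of_lt_cube (h : Admissible w t f) {n : ℕ} (hn : n < t ^ 3) :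
    n < 2 ^ f :=
  calc n < t ^ 3 := hn
    _ ≤ t ^ 4 := Nat.pow_le_pow_right h.blockLength_pos (by norm_num)
    _ ≤ 2 ^ f := h.blockLength_pow_le

theorem Admissible.length_denseBits_lt (h : Admissible w t f) (hβ : Monotone β)
    (hg : groupSpan t β g < t ^ 3) : (denseBits t f β g).length < 2 ^ w := by
  have hf := h.fieldLength_le
  have ht := h.le_blockLength
  calc (denseBits t f β g).length ≤ 3 * t * f + groupSpan t β g * f := length_denseBits_le hβ f g
    _ ≤ 3 * t * t + t ^ 3 * t := by gcongr
    _ ≤ t ^ 3 * t + t ^ 3 * t := by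
        gcongr
        nlinarith [Nat.mul_le_mul_left (t * t) ht]
    _ = t ^ 4 * 2 := by ring
    _ ≤ 2 ^ f * 2 := Nat.mul_le_mul_right _ h.blockLength_pow_le
    _ = 2 ^ (f + 1) := (pow_succ 2 f).symm
    _ < 2 ^ w := Nat.pow_lt_pow_right one_lt_two (by have := h.blockLength_le; lia)

theorem monotone_subgroupValue (hβ : Monotone β) (t J : ℕ) : Monotone (subgroupValue t β J) :=
  fun _ _ h => Nat.sub_le_sub_right (hβ (Nat.add_le_add_left h _)) _

theorem subgroupValue_le (hβ : Monotone β) (J : ℕ) {s : ℕ} (hs : s < t) :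
    subgroupValue t β J s ≤ subgroupSpan t β J :=
  Nat.sub_le_sub_right (hβ (by rw [add_one_mul]; exact Nat.add_le_add_left hs.le _)) _

end DenseGroupBounds

/-- Entry `i` of the directory at the address `base`. -/
def Expr.directory (base i : Expr) : Expr := readBits base (i * fieldLength) fieldLength

/-- Value `s` of subgroup `j`, relative to the first value of the subgroup, in the dense group at
the address `base`. -/
def Expr.subgroupValue (k : ℕ) (base j s : Expr) : Expr :=
  let position := directory base (blockLength + j)
  let span := directory base (blockLength + blockLength + j)
  .ite span blockLength
    (decode (k + 4) (blockLength + blockLength) base span position s)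
    (readBits base (position + s * fieldLength) fieldLength)

/-- Value `r`, relative to the first value, of the dense group at the address `base`. -/
def Expr.denseValue (k : ℕ) (base r : Expr) : Expr :=
  directory base (r / blockLength) + subgroupValue k base (r / blockLength) (r % blockLength)

/-- Entry `i` of the monotone sequence that is stored in sections `k, …, k + 4`. -/
def Expr.monotone (k : ℕ) (i : Expr) : Expr :=
  let g := i / (blockLength * blockLength)
  let r := i % (blockLength * blockLength)
  let base := sectionStart (k + 3) + word (k + 2) g
  .ite (.const 0) (word (k + 1) g) (.load (base + r)) (word k g + denseValue k base r)

namespace HasParameters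

variable {w t f k a g : ℕ} {β : ℕ → ℕ} {D : List Bool} {x : BitVec w} {base : Expr}

theorem directory (hp : HasParameters w t f D) (hβ : Monotone β) (hg : groupSpan t β g < t ^ 3)
    (h : StoredAt w D a (denseBits t f β g)) (ha : HasValue w D x base a) {i : Expr} {n v : ℕ}
    (hi : HasValue w D x i n) (hn : n < 3 * t)
    (hv : ContainsAt (denseBits t f β g) (n * f) (toBits f v)) (hvf : v < 2 ^ f) :
    HasValue w D x (.directory base i) v := by
  have hle : n * f ≤ (denseBits t f β g).length := by
    rw [length_denseBits]
    exact (Nat.mul_le_mul_right f hn.le).trans (Nat.le_add_right _ _)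
  have hlt := hle.trans_lt (hp.length_denseBits_lt hβ hg)
  exact h.bits hp.wordSize ha (hi.mul hp.fieldLength hlt) hp.fieldLength hp.fieldLength_lt hv hle
    hvf

theorem subgroupValue (hp : HasParameters w t f D) (hβ : Monotone β)
    (hg : groupSpan t β g < t ^ 3) (h : StoredAt w D a (denseBits t f β g))
    (htable : HasSection w D (k + 4) (monotoneTable w t f)) (ha : HasValue w D x base a)
    {j s : Expr} {m n : ℕ} (hj : HasValue w D x j m) (hm : m < t) (hs : HasValue w D x s n)
    (hn : n < t) :
    HasValue w D x (.subgroupValue k base j s) (subgroupValue t β (g * t + m) n) := by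
  have htf := hp.blockLength_mul_lt
  have hfw : 2 ^ f < 2 ^ w := Nat.pow_lt_pow_right one_lt_two hp.fieldLength_lt
  have h3t : 3 * t < 2 ^ w :=
    (Nat.mul_le_mul_right t (by have := hp.le_blockLength; lia)).trans_lt (htf.trans hfw)
  have hsub := containsAt_denseBits_subgroup f β g hm
  have hend := subgroupPosition_add_le f β g hm
  have hvalue : FID.subgroupValue t β (g * t + m) n ≤ subgroupSpan t β (g * t + m) :=
    subgroupValue_le hβ _ hn
  have hspanlt : subgroupSpan t β (g * t + m) < 2 ^ f :=
    hp.lt_two_pow_of_lt_cube ((subgroupSpan_le_groupSpan hβ g hm).trans_lt hg)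
  have hwidth := hp.blockLength (x := x).add hp.blockLength (by lia)
  have hposition := hp.directory hβ hg h ha (hp.blockLength.add hj (by lia)) (by lia)
    (containsAt_denseBits_position f β g hm) (hp.subgroupPosition_lt hm)
  have hspan := hp.directory hβ hg h ha (hwidth.add hj (by lia)) (by lia)
    (containsAt_denseBits_span f β g hm) hspanlt
  by_cases hcoded : subgroupSpan t β (g * t + m) < t
  · have hmono := monotone_subgroupValue hβ t (g * t + m)
    have hle (i : ℕ) (hi : i < t) := subgroupValue_le hβ (g * t + m) hi
    rw [subgroupBits, if_pos hcoded] at hsub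
    have hdecode := monotoneDecode_monotoneCode hmono hle hn
    refine .ite_of_lt hspan hp.blockLength hcoded ?_
    rw [← hdecode]
    exact hp.decode htable hwidth (by have := hp.blockLength_le; have := hp.blockLength_pos; lia)
      ha h hspan hcoded hposition hsub (monotoneCode_lt hmono hle hp.blockLength_succ_le)
      ((min_le_right _ _).trans (by lia)) (by lia) hs hn (by rw [hdecode]; lia)
  · rw [subgroupBits, if_neg hcoded] at hsub hend
    rw [length_array] at hend
    have hnf : n * f ≤ t * f := Nat.mul_le_mul_right _ hn.le
    have hlt := hp.length_denseBits_lt hβ hg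
    exact .ite_of_not_lt hspan hp.blockLength hcoded <|
      h.bits hp.wordSize ha (hposition.add (hs.mul hp.fieldLength (by lia)) (by lia))
        hp.fieldLength hp.fieldLength_lt (hsub.trans (containsAt_array _ hn)) (by lia) (by lia)

theorem denseValue (hp : HasParameters w t f D) (hβ : Monotone β)
    (hg : groupSpan t β g < t ^ 3) (h : StoredAt w D a (denseBits t f β g))
    (htable : HasSection w D (k + 4) (monotoneTable w t f)) (ha : HasValue w D x base a)
    {r : Expr} {n : ℕ} (hr : HasValue w D x r n) (hn : n < t * t)
    (hlt : β (g * t * t + n) < 2 ^ w) :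
    HasValue w D x (.denseValue k base r) (β (g * t * t + n) - β (g * t * t)) := by
  have hj : n / t < t := Nat.div_lt_of_lt_mul hn
  have hindex : (g * t + n / t) * t + n % t = g * t * t + n := by
    rw [add_mul, add_assoc, Nat.div_add_mod']
  have hfirst : β (g * t * t) ≤ β ((g * t + n / t) * t) :=
    hβ (Nat.mul_le_mul_right _ (Nat.le_add_right _ _))
  have hoffset : subgroupOffset t β g (n / t) < 2 ^ f :=
    hp.lt_two_pow_of_lt_cube ((subgroupOffset_le_groupSpan hβ g hj.le).trans_lt hg)
  have hsum : subgroupOffset t β g (n / t) + FID.subgroupValue t β (g * t + n / t) (n % t) =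
      β (g * t * t + n) - β (g * t * t) := by
    have hmono : β ((g * t + n / t) * t) ≤ β (g * t * t + n) := hβ (by lia)
    rw [subgroupOffset, FID.subgroupValue, hindex]
    lia
  rw [← hsum]
  exact (hp.directory hβ hg h ha (hr.div hp.blockLength) (by lia)
    (containsAt_denseBits_offset f β g hj) hoffset).add
    (hp.subgroupValue hβ hg h htable ha (hr.div hp.blockLength) hj (hr.mod hp.blockLength)
      (Nat.mod_lt _ hp.blockLength_pos)) (by lia)

theorem monotone (hp : HasParameters w t f D) (hβ : Monotone β) {G : ℕ}
    (hD : HasMonotone w t f β D k G) {i : Expr} {n : ℕ} (hi : HasValue w D x i n)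
    (hn : n < G * t * t) (hlt : β n < 2 ^ w) : HasValue w D x (.monotone k i) (β n) := by
  have hfw : 2 ^ f < 2 ^ w := Nat.pow_lt_pow_right one_lt_two hp.fieldLength_lt
  have htt := hp.blockLength (x := x).mul hp.blockLength (hp.blockLength_mul_lt.trans hfw)
  have hpos : 0 < t * t := Nat.mul_pos hp.blockLength_pos hp.blockLength_pos
  have hr : n % (t * t) < t * t := Nat.mod_lt _ hpos
  have hg : n / (t * t) < G := by rwa [Nat.div_lt_iff_lt_mul hpos, ← mul_assoc]
  have hindex : n / (t * t) * t * t + n % (t * t) = n := by rw [mul_assoc, Nat.div_add_mod']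
  set g := n / (t * t)
  have hfirst : β (g * t * t) ≤ β n := hβ (by lia)
  have hgroup := hD.data.storedAt.of_concat_pad hp.wordSize_pos hg
  have hbase := (hp.sectionStart (x := x) hD.data.index_lt).add
    (hp.word hD.pointers (hi.div htt) hg (by have := hgroup.end_lt; lia))
    (by have := hgroup.end_lt; lia)
  have hone : 1 < 2 ^ w := hp.lt_two_pow_of_lt (by norm_num)
  have hflag := hp.word hD.flags (hi.div htt) hg (by split_ifs <;> lia)
  have hzero : HasValue w D x (.const 0) 0 := hasValue_const (by positivity)
  by_cases hspan : t ^ 3 ≤ groupSpan t β g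
  · rw [if_pos hspan] at hflag
    rw [groupBits, if_pos hspan] at hgroup
    refine .ite_of_lt hzero hflag one_pos ?_
    simpa only [hindex] using
      hgroup.word hp.wordSize_pos hbase (hi.mod htt) hr (by rwa [hindex])
  · rw [if_neg hspan] at hflag
    rw [groupBits, if_neg hspan] at hgroup
    have hdense := hp.denseValue hβ (not_le.mp hspan) hgroup hD.table hbase (hi.mod htt) hr
      (by rwa [hindex])
    rw [hindex] at hdense
    have hsum := (hp.word hD.firsts (hi.div htt) hg (hfirst.trans_lt hlt)).add hdense
      (by rwa [Nat.add_sub_cancel' hfirst])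
    rw [Nat.add_sub_cancel' hfirst] at hsum
    exact .ite_of_not_lt hzero hflag (lt_irrefl 0) hsum

end HasParameters

/-! ### Counting and selecting by blocks -/

section Count

variable {p p' : ℕ → Prop} [DecidablePred p] {a i j t : ℕ}

theorem count_add_of_iff [DecidablePred p'] (h : ∀ k < t, p' k ↔ p (a + k)) (hj : j ≤ t) :
    Nat.count p (a + j) = Nat.count p a + Nat.count p' j := by
  have hcongr : Nat.count (fun k => p (a + k)) j = Nat.count p' j := by
    simp only [Nat.count_eq_card_filter_range]
    exact congrArg _ <| Finset.filter_congr fun k hk =>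
      (h k ((Finset.mem_range.mp hk).trans_le hj)).symm
  rw [Nat.count_add, hcongr]

theorem sub_count_lt_of_iff [DecidablePred p'] (h : ∀ k < t, p' k ↔ p (a + k))
    (hle : Nat.count p a ≤ i) (hi : i < Nat.count p (a + t)) :
    i - Nat.count p a < Nat.count p' t := by
  rw [count_add_of_iff h le_rfl] at hi
  lia

theorem nth_eq_add_nth_of_iff (h : ∀ k < t, p' k ↔ p (a + k)) (hle : Nat.count p a ≤ i)
    (hi : i < Nat.count p (a + t)) : Nat.nth p i = a + Nat.nth p' (i - Nat.count p a) := by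
  classical
  have hcount := sub_count_lt_of_iff h hle hi
  have hfinite (hf : (Set.ofPred p').Finite) : i - Nat.count p a < hf.toFinset.card :=
    hcount.trans_le (Nat.count_le_card hf t)
  have hlt := Nat.nth_lt_of_lt_count hcount
  have hrank : Nat.count p (a + Nat.nth p' (i - Nat.count p a)) = i := by
    rw [count_add_of_iff h hlt.le, Nat.count_nth hfinite, Nat.add_sub_cancel' hle]
  rw [← Nat.nth_count ((h _ hlt).mp (Nat.nth_mem _ hfinite)), hrank]

end Count

section Blocks

variable (t : ℕ) (p : ℕ → Prop) [DecidablePred p]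

/-- The number of solutions of `p` before block `b`, for blocks of length `t`. -/
def blockRank (b : ℕ) : ℕ := Nat.count p (b * t)

/-- The block, among the first `M` blocks of length `t`, that contains the solution of `p` with
`i` predecessors. -/
def blockSelect (M i : ℕ) : ℕ := Nat.findGreatest (fun b => blockRank t p b ≤ i) M

theorem monotone_blockRank : Monotone (blockRank t p) := fun _ _ h =>
  Nat.count_monotone p (Nat.mul_le_mul_right t h)

theorem blockRank_succ_le (b : ℕ) : blockRank t p (b + 1) ≤ blockRank t p b + t := by
  rw [blockRank, add_mul, one_mul, Nat.count_add]
  exact Nat.add_le_add_left (Nat.count_le _) _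

theorem blockRank_le (b : ℕ) : blockRank t p b ≤ b * t := Nat.count_le p

theorem monotone_blockSelect (M : ℕ) : Monotone (blockSelect t p M) := fun _ _ h =>
  Nat.findGreatest_mono (fun _ h' => h'.trans h) le_rfl

theorem blockSelect_le (M i : ℕ) : blockSelect t p M i ≤ M := Nat.findGreatest_le M

theorem blockRank_blockSelect_le (M i : ℕ) : blockRank t p (blockSelect t p M i) ≤ i :=
  Nat.findGreatest_spec (P := fun b => blockRank t p b ≤ i) M.zero_le (by simp [blockRank])

variable {t p} {M i : ℕ}

theorem blockSelect_lt (hi : i < blockRank t p M) : blockSelect t p M i < M :=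
  (blockSelect_le t p M i).lt_of_ne fun h =>
    (h ▸ blockRank_blockSelect_le t p M i).not_gt hi

theorem lt_blockRank_blockSelect_succ (hi : i < blockRank t p M) :
    i < blockRank t p (blockSelect t p M i + 1) := by
  by_contra! h
  exact (Nat.le_findGreatest (P := fun b => blockRank t p b ≤ i) (blockSelect_lt hi) h).not_gt
    (Nat.lt_succ_self _)

end Blocks

/-! ### The dictionary -/

/-- Bit `y` of the characteristic sequence of `S` is `q`. The value `q = true` stands for `S` and
`q = false` for its complement, so that both are treated at once. -/
def HasBit (q : Bool) (S : Finset ℕ) (y : ℕ) : Prop := decide (y ∈ S) = q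

instance (q : Bool) (S : Finset ℕ) : DecidablePred (HasBit q S) := fun _ =>
  inferInstanceAs (Decidable (_ = _))

section Code

variable (t : ℕ) (S : Finset ℕ)

/-- The elements of block `b`, relative to its beginning. -/
def block (b : ℕ) : Finset ℕ := {j ∈ Finset.range t | b * t + j ∈ S}

/-- The number of bits of the code of a block with `k` elements. -/
def blockCodeLength (k : ℕ) : ℕ := Nat.clog 2 (t.choose k)

/-- The possible blocks with `k` elements. -/
def blocksOfCard (k : ℕ) : Finset (Finset ℕ) := (Finset.range t).powersetCard k

/-- The code of block `b` among the blocks with the same number of elements. -/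
noncomputable def blockCode (b : ℕ) : ℕ := encode (blocksOfCard t (block t S b).card) (block t S b)

/-- The code of block `b` as a bit string. -/
noncomputable def blockBits (b : ℕ) : List Bool :=
  toBits (blockCodeLength t (block t S b).card) (blockCode t S b)

/-- The position of the code of block `b` in the concatenation of all codes. -/
def codePosition (b : ℕ) : ℕ := ∑ c ∈ Finset.range b, blockCodeLength t (block t S c).card

theorem hasBit_block (q : Bool) (b j : ℕ) (hj : j < t) :
    HasBit q (block t S b) j ↔ HasBit q S (b * t + j) := by
  simp [HasBit, block, hj]

theorem block_mem_blocksOfCard (b : ℕ) : block t S b ∈ blocksOfCard t (block t S b).card :=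
  Finset.mem_powersetCard.mpr ⟨Finset.filter_subset _ _, rfl⟩

theorem card_block_le (b : ℕ) : (block t S b).card ≤ t :=
  (Finset.card_filter_le _ _).trans_eq (Finset.card_range t)

theorem blockCodeLength_le (k : ℕ) : blockCodeLength t k ≤ t :=
  Nat.clog_le_of_le_pow (Nat.choose_le_two_pow t k)

theorem blockCode_lt (b : ℕ) :
    blockCode t S b < 2 ^ blockCodeLength t (block t S b).card := by
  refine (encode_lt (block_mem_blocksOfCard t S b)).trans_le ?_
  rw [blocksOfCard, Finset.card_powersetCard, Finset.card_range]
  exact Nat.le_pow_clog one_lt_two _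

theorem monotone_codePosition : Monotone (codePosition t S) := fun _ _ h =>
  Finset.sum_le_sum_of_subset (Finset.range_mono h)

theorem codePosition_succ_le (b : ℕ) : codePosition t S (b + 1) ≤ codePosition t S b + t := by
  rw [codePosition, Finset.sum_range_succ]
  exact Nat.add_le_add_left (blockCodeLength_le t _) _

theorem codePosition_le (b : ℕ) : codePosition t S b ≤ b * t := by
  simpa [codePosition] using apply_add_le_of_succ_le (codePosition_succ_le t S) 0 b

theorem length_concat_blockBits (M : ℕ) :
    (concat M (blockBits t S)).length = codePosition t S M := by
  simp only [length_concat, blockBits, length_toBits, codePosition]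

end Code

/-- The number of bits `q` before position `j` if bit `j` is `q`, and `t` otherwise. -/
def localRank (t : ℕ) (q : Bool) (A : Finset ℕ) (j : ℕ) : ℕ :=
  if HasBit q A j then Nat.count (HasBit q A) j else t

/-- The table of the values of `F` on all blocks. -/
noncomputable def blockTable (w t : ℕ) (F : Finset ℕ → ℕ → ℕ) : List Bool :=
  decodingTable w t t (t + 1) (blockCodeLength t) fun c v => F (decode (blocksOfCard t c) v)

section Sections

variable (w t f M : ℕ) (S : Finset ℕ)

/-- Sections `k, …, k + 8` of the memory `D` serve rank and select for the bits `q`. -/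
structure HasQueries (q : Bool) (D : List Bool) (k : ℕ) : Prop where
  rankSamples : HasSection w D k (samples w t M (blockRank t (HasBit q S)))
  rankOffsets : HasSection w D (k + 1) (sampleOffsets t f M (blockRank t (HasBit q S)))
  select : HasMonotone w t f (blockSelect t (HasBit q S) M) D (k + 2) (M / t + 1)
  rankTable : HasSection w D (k + 7) (blockTable w t (localRank t q))
  selectTable : HasSection w D (k + 8) (blockTable w t fun A => Nat.nth (HasBit q A))

/-- The first of the sections for the bits `q`. -/
def querySection (q : Bool) : ℕ := if q then 4 else 13

/-- The memory `D` contains the dictionary of `S` with `M` blocks. -/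
structure HasDictionary (D : List Bool) : Prop extends HasParameters w t f D where
  codeSamples : HasSection w D 0 (samples w t M (codePosition t S))
  codeOffsets : HasSection w D 1 (sampleOffsets t f M (codePosition t S))
  cards : HasSection w D 2 (array f M fun b => (block t S b).card)
  codes : HasSection w D 3 (concat M (blockBits t S))
  queries (q : Bool) : HasQueries w t f M S q D (querySection q)
  mul_fieldLength_lt : M * f < 2 ^ w
  mul_blockLength_lt : ∀ b < M, b * t < 2 ^ w

end Sections

namespace Expr

/-- Entry `j` for block `b` of the block table in section `k`. -/
def blockEntry (k : ℕ) (b j : Expr) : Expr :=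
  decode k blockLength (sectionStart 3) (field 2 b) (sampled 0 1 b) j

/-- The number of bits `q` before block `b`. -/
def blockRank (q : Bool) (b : Expr) : Expr := sampled (querySection q) (querySection q + 1) b

/-- The rank query for the bits `q`. -/
def rank (q : Bool) : Expr :=
  let r := blockEntry (querySection q + 7) (arg / blockLength) (arg % blockLength)
  .ite r blockLength (blockRank q (arg / blockLength) + r) negOne

/-- The select query for the bits `q`. -/
def select (q : Bool) : Expr :=
  let i := arg - const 1
  let b := monotone (querySection q + 2) i
  b * blockLength + blockEntry (querySection q + 8) b (i - blockRank q b)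

end Expr

namespace HasDictionary

variable {w t f M B : ℕ} {q : Bool} {S : Finset ℕ} {D : List Bool} {x : BitVec w} {b : Expr}

theorem blockEntry (h : HasDictionary w t f M S D) {k s : ℕ} {F : Finset ℕ → ℕ → ℕ} {j : Expr}
    (hk : HasSection w D k (blockTable w t F)) (hb : HasValue w D x b B) (hB : B < M)
    (hj : HasValue w D x j s) (hs : s < t) (hF : F (block t S B) s < 2 ^ w) :
    HasValue w D x (.blockEntry k b j) (F (block t S B) s) := by
  have htw : t < w := by have := h.blockLength_le; have := h.blockLength_pos; lia
  have hBf : B * f ≤ M * f := Nat.mul_le_mul_right f hB.le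
  have hMf := h.mul_fieldLength_lt
  have hcard : (block t S B).card < 2 ^ f :=
    (card_block_le t S B).trans_lt ((Nat.lt_succ_self t).trans_le h.blockLength_succ_le)
  have hposition : codePosition t S B < 2 ^ w :=
    (codePosition_le t S B).trans_lt (h.mul_blockLength_lt B hB)
  have hcode : ContainsAt (concat M (blockBits t S)) (codePosition t S B) (blockBits t S B) := by
    have hcontains := containsAt_concat (blockBits t S) hB
    rwa [← length_concat, length_concat_blockBits] at hcontains
  have hentry := decode_encode (block_mem_blocksOfCard t S B)
  rw [← hentry] at hF ⊢
  refine h.decode hk h.blockLength htw (h.sectionStart h.codes.index_lt) h.codes.storedAt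
    (h.field h.cards hb hB hcard (by lia)) (Nat.lt_succ_of_le (card_block_le t S B))
    (h.sampled h.codeSamples h.codeOffsets (monotone_codePosition t S) (codePosition_succ_le t S)
      hb hB hposition (by lia)) hcode (blockCode_lt t S B) (blockCodeLength_le t _) ?_ hj hs hF
  rw [length_concat_blockBits]
  exact monotone_codePosition t S hB.le

theorem blockRank (h : HasDictionary w t f M S D) (hb : HasValue w D x b B) (hB : B < M) :
    HasValue w D x (.blockRank q b) (FID.blockRank t (HasBit q S) B) := by
  have hBf : B * f ≤ M * f := Nat.mul_le_mul_right f hB.le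
  exact h.sampled (h.queries q).rankSamples (h.queries q).rankOffsets (monotone_blockRank t _)
    (blockRank_succ_le t _) hb hB
    ((blockRank_le t _ B).trans_lt (h.mul_blockLength_lt B hB))
    (hBf.trans_lt h.mul_fieldLength_lt)

theorem eval_rank (h : HasDictionary w t f M S D) {y : ℕ} (hy : HasValue w D x .arg y)
    (hyM : y / t < M) :
    (Expr.rank q).eval (memOf w D) x =
      BitVec.ofInt w (if HasBit q S y then (Nat.count (HasBit q S) y : ℤ) else -1) := by
  have hmod : y % t < t := Nat.mod_lt _ h.blockLength_pos
  have hy' : y / t * t + y % t = y := Nat.div_add_mod' y t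
  have hblock := hasBit_block t S q (y / t)
  have hbit := hblock _ hmod
  have hcount := count_add_of_iff hblock hmod.le
  rw [hy'] at hbit hcount
  have hlocal : Nat.count (HasBit q (block t S (y / t))) (y % t) < t :=
    (Nat.count_le _).trans_lt hmod
  have hb := hy.div h.blockLength
  have hentry := h.blockEntry (h.queries q).rankTable hb hyM (hy.mod h.blockLength) hmod
    (lt_of_le_of_lt (by rw [localRank]; split_ifs <;> lia) (h.blockLength (x := x)).lt_two_pow)
  rw [localRank] at hentry
  by_cases hq : HasBit q S y
  · rw [if_pos (hbit.mpr hq)] at hentry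
    rw [if_pos hq, Expr.rank, hentry.eval_ite_of_lt h.blockLength hlocal, hcount]
    refine ((h.blockRank hb hyM).add hentry ?_).eval_eq
    exact hcount ▸ (Nat.count_le _).trans_lt hy.lt_two_pow
  · rw [if_neg (hbit.not.mpr hq)] at hentry
    rw [if_neg hq, Expr.rank, hentry.eval_ite_of_not_lt h.blockLength (lt_irrefl t),
      eval_negOne]

theorem select (h : HasDictionary w t f M S D) {i : ℕ} (hi : HasValue w D x .arg i) (hi0 : 1 ≤ i)
    (hiM : i - 1 < FID.blockRank t (HasBit q S) M)
    (hlt : Nat.nth (HasBit q S) (i - 1) < 2 ^ w) :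
    HasValue w D x (.select q) (Nat.nth (HasBit q S) (i - 1)) := by
  have hpred := hi.sub (hasValue_const (a := 1) (h.lt_two_pow_of_lt (by norm_num))) hi0
  have hM : i - 1 < (M / t + 1) * t * t :=
    calc i - 1 < M * t := hiM.trans_le (blockRank_le t _ M)
      _ ≤ (M / t + 1) * t * t :=
        Nat.mul_le_mul_right t (Nat.lt_mul_of_div_lt (Nat.lt_succ_self _) h.blockLength_pos).le
  have hBM := blockSelect_lt hiM
  have hle := blockRank_blockSelect_le t (HasBit q S) M (i - 1)
  have hlt_succ := lt_blockRank_blockSelect_succ hiM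
  have hBlt : blockSelect t (HasBit q S) M (i - 1) * t < 2 ^ w :=
    h.mul_blockLength_lt _ hBM
  have hb := h.monotone (monotone_blockSelect t _ M) (h.queries q).select hpred hM
    ((Nat.le_mul_of_pos_right _ h.blockLength_pos).trans_lt hBlt)
  set B := blockSelect t (HasBit q S) M (i - 1)
  rw [FID.blockRank] at hle
  rw [FID.blockRank, add_one_mul] at hlt_succ
  have hnth := nth_eq_add_nth_of_iff (hasBit_block t S q B) hle hlt_succ
  have hcount := (sub_count_lt_of_iff (hasBit_block t S q B) hle hlt_succ).trans_le
    (Nat.count_le _)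
  rw [hnth] at hlt ⊢
  have hentry := h.blockEntry (h.queries q).selectTable hb hBM (hpred.sub (h.blockRank hb hBM) hle)
    hcount (by rw [FID.blockRank]; lia)
  exact (hb.mul h.blockLength hBlt).add hentry hlt

end HasDictionary

/-! ### The layout of the memory -/

section Layout

variable (w t f : ℕ) (secs : List (List Bool))

/-- The first words of the memory: a nonzero word, the parameters and the addresses of the
sections. -/
def header : ℕ → ℕ
  | 0 => 1
  | 1 => w
  | 2 => t
  | 3 => f
  | k + 4 => 4 + secs.length + ∑ j ∈ Finset.range k, wordCount w (secs.getD j [])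

/-- The memory that consists of a header and the given sections, each of which begins with a new
word. -/
def layout : List Bool :=
  array w (4 + secs.length) (header w t f secs) ++
    concat secs.length fun k => pad w (secs.getD k [])

variable {w} {secs}

theorem length_layout (hw : 0 < w) :
    (layout w t f secs).length =
      (4 + secs.length + ∑ j ∈ Finset.range secs.length, wordCount w (secs.getD j [])) * w := by
  rw [layout, List.length_append, length_array, length_concat_pad hw, ← add_mul]

theorem length_layout_le (hw : 0 < w) :
    (layout w t f secs).length ≤ (secs.map List.length).sum + (4 + 2 * secs.length) * w := by
  have hsum : ∑ j ∈ Finset.range secs.length, wordCount w (secs.getD j []) * w ≤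
      (secs.map List.length).sum + secs.length * w :=
    calc _ ≤ ∑ j ∈ Finset.range secs.length, ((secs.getD j []).length + w) :=
          Finset.sum_le_sum fun j _ => wordCount_mul_le w _
      _ = (secs.map List.length).sum + secs.length * w := by
          rw [Finset.sum_add_distrib, Finset.sum_range, ← Fin.sum_univ_fun_getElem]
          simp
  rw [length_layout t f hw, add_mul, Finset.sum_mul]
  lia

variable {t f}

theorem readBits_layout {k : ℕ} (hk : k < 4 + secs.length) (h : header w t f secs k < 2 ^ w) :
    readBits (layout w t f secs) (k * w) w = header w t f secs k :=
  (containsAt_array _ hk).append_right.readBits_eq h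

theorem hasSection_layout (hw : 0 < w) (hsecs : secs.length ≤ 60)
    (hlen : (layout w t f secs).length + w < 2 ^ w * w) {k : ℕ} {Y : List Bool}
    (hk : secs[k]? = some Y) : HasSection w (layout w t f secs) k Y := by
  obtain ⟨hklt, rfl⟩ := List.getElem?_eq_some_iff.mp hk
  rw [length_layout t f hw, ← add_one_mul] at hlen
  have hend := lt_of_mul_lt_mul_right hlen w.zero_le
  have hle : ∑ j ∈ Finset.range k, wordCount w (secs.getD j []) ≤
      ∑ j ∈ Finset.range secs.length, wordCount w (secs.getD j []) :=
    Finset.sum_le_sum_of_subset (Finset.range_mono hklt.le)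
  have hheader : header w t f secs (4 + k) =
      4 + secs.length + ∑ j ∈ Finset.range k, wordCount w (secs.getD j []) := by
    rw [add_comm 4 k, header]
  have hstart : sectionStart w (layout w t f secs) k =
      4 + secs.length + ∑ j ∈ Finset.range k, wordCount w (secs.getD j []) :=
    (readBits_layout (by lia) (by lia)).trans hheader
  have hbody : StoredAt w (layout w t f secs) (4 + secs.length)
      (concat secs.length fun k => pad w (secs.getD k [])) := by
    refine ⟨?_, ?_⟩
    · rw [← length_array w (4 + secs.length) (header w t f secs)]
      exact ContainsAt.length_append _ _
    · rwa [length_concat_pad hw, Nat.mul_div_cancel _ hw]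
  refine ⟨by lia, ?_⟩
  rw [hstart, ← List.getD_eq_getElem secs [] hklt]
  exact hbody.of_concat_pad hw hklt

end Layout

section Dictionary

variable (w t f M : ℕ) (S : Finset ℕ)

/-- The sections with the codes of the blocks. -/
noncomputable def codeSections : List (List Bool) :=
  [samples w t M (codePosition t S), sampleOffsets t f M (codePosition t S),
    array f M fun b => (block t S b).card, concat M (blockBits t S)]

/-- The sections for rank and select for the bits `q`. -/
noncomputable def querySections (q : Bool) : List (List Bool) :=
  [samples w t M (blockRank t (HasBit q S)), sampleOffsets t f M (blockRank t (HasBit q S)),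
    groupFirsts w t (blockSelect t (HasBit q S) M) (M / t + 1),
    groupFlags w t (blockSelect t (HasBit q S) M) (M / t + 1),
    groupPointers w t f (blockSelect t (HasBit q S) M) (M / t + 1),
    groupData w t f (blockSelect t (HasBit q S) M) (M / t + 1),
    monotoneTable w t f,
    blockTable w t (localRank t q),
    blockTable w t fun A => Nat.nth (HasBit q A)]

/-- The memory with the dictionary of `S`. -/
noncomputable def dictionary : List Bool :=
  layout w t f (codeSections w t f M S ++ querySections w t f M S true ++
    querySections w t f M S false)

variable {w t f M S}

theorem hasDictionary_dictionary (h : Admissible w t f) (hMf : M * f < 2 ^ w)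
    (hMt : ∀ b < M, b * t < 2 ^ w) (hlen : (dictionary w t f M S).length + w < 2 ^ w * w) :
    HasDictionary w t f M S (dictionary w t f M S) := by
  have hww : w < 2 ^ w := Nat.lt_two_pow_self
  have htw : t < 2 ^ w := by have := h.blockLength_le; lia
  have hfw : f < 2 ^ w := h.fieldLength_lt.trans hww
  have hsec {k : ℕ} {Y : List Bool} := hasSection_layout (k := k) (Y := Y) h.wordSize_pos
    (by simp only [codeSections, querySections, List.length_append, List.length_cons,
      List.length_nil]; norm_num) hlen
  exact {
    toAdmissible := h
    readBits_wordSize := readBits_layout (k := 1) (by lia) hww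
    readBits_blockLength := readBits_layout (k := 2) (by lia) htw
    readBits_fieldLength := readBits_layout (k := 3) (by lia) hfw
    codeSamples := hsec rfl
    codeOffsets := hsec rfl
    cards := hsec rfl
    codes := hsec rfl
    queries
      | true => ⟨hsec rfl, hsec rfl, ⟨hsec rfl, hsec rfl, hsec rfl, hsec rfl, hsec rfl⟩,
          hsec rfl, hsec rfl⟩
      | false => ⟨hsec rfl, hsec rfl, ⟨hsec rfl, hsec rfl, hsec rfl, hsec rfl, hsec rfl⟩,
          hsec rfl, hsec rfl⟩
    mul_fieldLength_lt := hMf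
    mul_blockLength_lt := hMt }

end Dictionary

/-! ### The size of the dictionary -/

section Size

variable {w t f M c : ℕ}

theorem succ_div_mul_le (h : t ≤ M) : (M / t + 1) * t ≤ 2 * M := by
  have := Nat.div_mul_le_self M t
  lia

theorem succ_div_mul_wordSize_le (hwc : w ≤ c * t) (h : t ≤ M) :
    (M / t + 1) * w ≤ 2 * (c * M) :=
  calc (M / t + 1) * w ≤ (M / t + 1) * (c * t) := Nat.mul_le_mul_left _ hwc
    _ = c * ((M / t + 1) * t) := by ring
    _ ≤ c * (2 * M) := Nat.mul_le_mul_left _ (succ_div_mul_le h)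
    _ = 2 * (c * M) := by ring

theorem length_decodingTable_le {B K : ℕ} (hwc : w ≤ c * t) (hK : K * 2 ^ B ≤ t * 2 ^ (2 * t))
    (hM : t ^ 3 * 2 ^ (2 * t) ≤ M) (len : ℕ → ℕ) (F : ℕ → ℕ → ℕ → ℕ) :
    (decodingTable w t B K len F).length ≤ c * M := by
  rw [decodingTable, length_array]
  calc K * 2 ^ B * t * w ≤ t * 2 ^ (2 * t) * t * (c * t) := by gcongr
    _ = c * (t ^ 3 * 2 ^ (2 * t)) := by ring
    _ ≤ c * M := Nat.mul_le_mul_left c hM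

theorem length_monotoneTable_le (hwc : w ≤ c * t) (hM : t ^ 3 * 2 ^ (2 * t) ≤ M) :
    (monotoneTable w t f).length ≤ c * M :=
  length_decodingTable_le hwc (by rw [two_mul]) hM ..

theorem length_blockTable_le (ht : 2 ≤ t) (hwc : w ≤ c * t) (hM : t ^ 3 * 2 ^ (2 * t) ≤ M)
    (F : Finset ℕ → ℕ → ℕ) : (blockTable w t F).length ≤ c * M := by
  refine length_decodingTable_le hwc ?_ hM ..
  calc (t + 1) * 2 ^ t ≤ (t * 2 ^ t) * 2 ^ t := by
        gcongr
        nlinarith [Nat.pow_le_pow_right two_pos (show 1 ≤ t by lia)]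
    _ = t * 2 ^ (2 * t) := by rw [two_mul, pow_add, mul_assoc]

theorem length_groupData_le (hw : 0 < w) (ht : 0 < t) (hwc : w ≤ c * t) (htM : t ≤ M)
    {β : ℕ → ℕ} (hβ : Monotone β) (hβM : ∀ i, β i ≤ M) :
    (groupData w t f β (M / t + 1)).length ≤ 7 * (M * f) + 3 * (c * M) := by
  refine Nat.le_of_mul_le_mul_left ((mul_length_groupData_le hβ hw f hβM _).trans ?_) ht
  calc (M / t + 1) * (t * (3 * t * f + w)) + M * (t * f + w)
      = (M / t + 1) * t * (3 * t * f + w) + M * (t * f + w) := by ring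
    _ ≤ 2 * M * (3 * t * f + c * t) + M * (t * f + c * t) :=
        Nat.add_le_add (Nat.mul_le_mul (succ_div_mul_le htM) (by lia)) (by gcongr)
    _ = t * (7 * (M * f) + 3 * (c * M)) := by ring

theorem sum_length_codeSections_le (hwc : w ≤ c * t) (htM : t ≤ M) (S : Finset ℕ) :
    ((codeSections w t f M S).map List.length).sum ≤
      codePosition t S M + 2 * (M * f) + 2 * (c * M) := by
  have := succ_div_mul_wordSize_le hwc htM
  simp only [codeSections, List.map_cons, List.map_nil, List.sum_cons, List.sum_nil, samples,
    sampleOffsets, length_array, length_concat_blockBits]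
  lia

theorem sum_length_querySections_le (hw : 0 < w) (ht : 2 ≤ t) (hwc : w ≤ c * t) (htM : t ≤ M)
    (hM : t ^ 3 * 2 ^ (2 * t) ≤ M) (S : Finset ℕ) (q : Bool) :
    ((querySections w t f M S q).map List.length).sum ≤ 8 * (M * f) + 14 * (c * M) := by
  have := succ_div_mul_wordSize_le hwc htM
  have := length_groupData_le (f := f) hw (by lia) hwc htM (monotone_blockSelect t (HasBit q S) M)
    (blockSelect_le t _ M)
  have := length_monotoneTable_le (f := f) hwc hM
  have := length_blockTable_le ht hwc hM (localRank t q)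
  have := length_blockTable_le ht hwc hM fun A => Nat.nth (HasBit q A)
  simp only [querySections, List.map_cons, List.map_nil, List.sum_cons, List.sum_nil, samples,
    sampleOffsets, groupFirsts, groupFlags, groupPointers, length_array]
  lia

theorem length_dictionary_le (h : Admissible w t f) (hwc : w ≤ c * t)
    (hM : t ^ 3 * 2 ^ (2 * t) ≤ M) (S : Finset ℕ) :
    (dictionary w t f M S).length ≤ codePosition t S M + 49 * c * (M * f) := by
  have ht := h.le_blockLength
  have hw := h.wordSize_pos
  have hc : 0 < c := Nat.pos_of_mul_pos_right (hw.trans_le hwc)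
  have hf : 0 < f := Nat.pos_of_ne_zero fun hf => by
    have := h.blockLength_succ_le
    rw [hf] at this
    lia
  have htM48 : 48 * t ≤ M :=
    calc 48 * t ≤ t ^ 2 * t := Nat.mul_le_mul_right t (by nlinarith)
      _ = t ^ 3 * 1 := by ring
      _ ≤ t ^ 3 * 2 ^ (2 * t) := Nat.mul_le_mul_left _ Nat.one_le_two_pow
      _ ≤ M := hM
  have hwM : 48 * w ≤ c * M :=
    calc 48 * w ≤ 48 * (c * t) := Nat.mul_le_mul_left _ hwc
      _ = c * (48 * t) := by ring
      _ ≤ c * M := Nat.mul_le_mul_left _ htM48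
  have hcM : c * M ≤ c * (M * f) := Nat.mul_le_mul_left _ (Nat.le_mul_of_pos_right _ hf)
  have hMf : M * f ≤ c * (M * f) := Nat.le_mul_of_pos_left _ hc
  have htM : t ≤ M := by lia
  have hcode := sum_length_codeSections_le (f := f) hwc htM S
  have hquery := sum_length_querySections_le (f := f) hw (by lia) hwc htM hM S
  have htrue := hquery true
  have hfalse := hquery false
  have hlayout := length_layout_le (secs := codeSections w t f M S ++
    querySections w t f M S true ++ querySections w t f M S false) t f hw
  simp only [List.map_append, List.sum_append] at hlayout
  have hcount : (codeSections w t f M S ++ querySections w t f M S true ++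
    querySections w t f M S false).length = 22 := rfl
  rw [hcount] at hlayout
  rw [dictionary, mul_assoc]
  lia

end Size

/-! ### The information-theoretic bound -/

theorem choose_mul_choose_le (a b c d : ℕ) :
    a.choose b * c.choose d ≤ (a + c).choose (b + d) := by
  rw [Nat.add_choose_eq]
  exact Finset.single_le_sum (f := fun ij : ℕ × ℕ => a.choose ij.1 * c.choose ij.2)
    (fun _ _ => Nat.zero_le _) (a := (b, d)) (by simp)

theorem two_pow_clog_le {n : ℕ} (hn : 0 < n) : 2 ^ Nat.clog 2 n ≤ 2 * n := by
  rcases (show 1 ≤ n from hn).eq_or_lt with rfl | h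
  · simp
  · have hlt := Nat.pow_pred_clog_lt_self one_lt_two h
    rw [← Nat.succ_pred_eq_of_pos (Nat.clog_pos one_lt_two h), pow_succ]
    lia

theorem card_block (t : ℕ) (S : Finset ℕ) (b : ℕ) :
    (block t S b).card = Nat.count (fun j => b * t + j ∈ S) t :=
  (Nat.count_eq_card_filter_range _ t).symm

theorem two_pow_codePosition_le (t : ℕ) (S : Finset ℕ) (b : ℕ) :
    2 ^ codePosition t S b ≤ 2 ^ b * (b * t).choose (Nat.count (· ∈ S) (b * t)) := by
  induction b with
  | zero => simp [codePosition]
  | succ b ih =>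
    rw [codePosition, Finset.sum_range_succ, ← codePosition, pow_add, add_one_mul, Nat.count_add,
      ← card_block]
    calc _ ≤ (2 ^ b * (b * t).choose (Nat.count (· ∈ S) (b * t))) *
          (2 * t.choose (block t S b).card) :=
        Nat.mul_le_mul ih (two_pow_clog_le (Nat.choose_pos (card_block_le t S b)))
      _ = 2 ^ (b + 1) * ((b * t).choose (Nat.count (· ∈ S) (b * t)) *
          t.choose (block t S b).card) := by ring
      _ ≤ _ := Nat.mul_le_mul_left _ (choose_mul_choose_le _ _ _ _)

theorem count_mem_eq_card {m : ℕ} {S : Finset ℕ} (hS : S ⊆ Finset.range m) :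
    Nat.count (· ∈ S) m = S.card := by
  rw [Nat.count_eq_card_filter_range, Finset.filter_mem_eq_inter, Finset.inter_eq_right.mpr hS]

theorem choose_count_le_choose_card {a m : ℕ} {S : Finset ℕ} (hS : S ⊆ Finset.range m)
    (ha : a ≤ m) : a.choose (Nat.count (· ∈ S) a) ≤ m.choose S.card := by
  obtain ⟨d, rfl⟩ := Nat.exists_eq_add_of_le ha
  rw [← count_mem_eq_card hS, Nat.count_add]
  exact (Nat.le_mul_of_pos_right _ (Nat.choose_pos (Nat.count_le _))).trans
    (choose_mul_choose_le _ _ _ _)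

theorem choose_le_two_pow_infoBound {n m : ℕ} (h : n ≤ m) : m.choose n ≤ 2 ^ infoBound n m := by
  have hlg : lg (m.choose n) ≤ infoBound n m := Nat.le_ceil _
  rw [lg, Real.logb_le_iff_le_rpow one_lt_two (Nat.cast_pos.mpr (Nat.choose_pos h)),
    Real.rpow_natCast] at hlg
  exact_mod_cast hlg

theorem codePosition_le_infoBound {m : ℕ} (t : ℕ) {S : Finset ℕ} (hS : S ⊆ Finset.range m) :
    codePosition t S (m / t + 1) ≤ infoBound S.card m + (m / t + t) := by
  have hcard : S.card ≤ m := by simpa using Finset.card_le_card hS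
  have hpow : 2 ^ codePosition t S (m / t) ≤ 2 ^ (m / t + infoBound S.card m) :=
    calc _ ≤ 2 ^ (m / t) * (m / t * t).choose (Nat.count (· ∈ S) (m / t * t)) :=
          two_pow_codePosition_le t S (m / t)
      _ ≤ 2 ^ (m / t) * m.choose S.card :=
          Nat.mul_le_mul_left _ (choose_count_le_choose_card hS (Nat.div_mul_le_self m t))
      _ ≤ 2 ^ (m / t) * 2 ^ infoBound S.card m :=
          Nat.mul_le_mul_left _ (choose_le_two_pow_infoBound hcard)
      _ = 2 ^ (m / t + infoBound S.card m) := (pow_add _ _ _).symm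
  have := (Nat.pow_le_pow_iff_right one_lt_two).mp hpow
  have := codePosition_succ_le t S (m / t)
  lia

/-! ### Correct queries -/

section Select

variable {m i x : ℕ} (p : ℕ → Prop) [DecidablePred p]

theorem card_filter_lt_filter_range (hx : x ≤ m) :
    {z ∈ {y ∈ Finset.range m | p y} | z < x}.card = Nat.count p x := by
  rw [Nat.count_eq_card_filter_range, Finset.filter_filter]
  congr 1
  ext y
  simp only [Finset.mem_filter, Finset.mem_range]
  constructor
  · exact fun h => ⟨h.2.2, h.2.1⟩
  · exact fun h => ⟨h.1.trans_le hx, h.2, h.1⟩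

theorem rank_filter_range (hx : x < m) :
    rank x {y ∈ Finset.range m | p y} = if p x then (Nat.count p x : ℤ) else -1 := by
  simp only [rank, card_filter_lt_filter_range p hx.le, Finset.mem_filter, Finset.mem_range, hx,
    true_and]

theorem exists_select_filter_range (hi : 1 ≤ i) (him : i ≤ {y ∈ Finset.range m | p y}.card) :
    ∃ y < m, p y ∧ Nat.count p y + 1 = i ∧ select i {y ∈ Finset.range m | p y} = y := by
  set A := {y ∈ Finset.range m | p y} with hA
  have hcard (hf : (Set.ofPred (· ∈ A)).Finite) : i - 1 < hf.toFinset.card := by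
    have hfA : hf.toFinset = A := by ext; simp
    rw [hfA]
    lia
  have hmem : select i A ∈ A := Nat.nth_mem (p := (· ∈ A)) (i - 1) hcard
  obtain ⟨hlt, hp⟩ : select i A < m ∧ p (select i A) := by
    simpa only [hA, Finset.mem_filter, Finset.mem_range] using hmem
  have hcount : Nat.count (· ∈ A) (select i A) = i - 1 := Nat.count_nth hcard
  have hcongr := count_add_of_iff (p := p) (p' := (· ∈ A)) (a := 0) (t := m)
    (fun k hk => by simp [hA, hk]) hlt.le
  rw [zero_add, Nat.count_zero, zero_add, hcount] at hcongr
  exact ⟨select i A, hlt, hp, by lia, rfl⟩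

theorem filter_hasBit_true {S : Finset ℕ} (hS : S ⊆ Finset.range m) :
    {y ∈ Finset.range m | HasBit true S y} = S := by
  simpa only [HasBit, decide_eq_true_eq, Finset.filter_mem_eq_inter] using
    Finset.inter_eq_right.mpr hS

theorem filter_hasBit_false (m : ℕ) (S : Finset ℕ) :
    {y ∈ Finset.range m | HasBit false S y} = Finset.range m \ S := by
  simp only [HasBit, decide_eq_false_iff_not, Finset.sdiff_eq_filter]

end Select

/-- The queries that evaluate `R q` and `L q` for rank and select on `S` (`q = true`) and on its
complement (`q = false`). -/
def queries (R L : Bool → Expr) : Queries :=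
  ⟨(R true).program, (L true).program, (R false).program, (L false).program⟩

/-- A running time that suffices for each of the four programs in `queries R L`. -/
def queryTime (R L : Bool → Expr) : ℕ :=
  (R true).program.length + (L true).program.length +
    ((R false).program.length + (L false).program.length)

/-- With the bit string `D` in memory, the expressions `R q` and `L q` have the right values for
rank and select queries on `S` (`q = true`) and on its complement (`q = false`). -/
structure Computes (w m : ℕ) (D : List Bool) (S : Finset ℕ) (R L : Bool → Expr) : Prop where
  eval_rank : ∀ q, ∀ y < m, (R q).eval (memOf w D) (BitVec.ofNat w y) =
    BitVec.ofInt w (if HasBit q S y then (Nat.count (HasBit q S) y : ℤ) else -1)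
  eval_select : ∀ q, ∀ y < m, HasBit q S y →
    (L q).eval (memOf w D) (BitVec.ofNat w (Nat.count (HasBit q S) y + 1)) = BitVec.ofInt w y

namespace Computes

variable {w m : ℕ} {D : List Bool} {S : Finset ℕ} {R L R' L' : Bool → Expr} {q : Bool}

theorem answers_rank (h : Computes w m D S R L) {T x : ℕ} (hT : (R q).program.length ≤ T)
    (hx : x < m) :
    Answers (R q).program T w D x (FID.rank x {y ∈ Finset.range m | HasBit q S y}) := by
  rw [rank_filter_range _ hx]
  exact Expr.answers_program hT (h.eval_rank q x hx)

theorem answers_select (h : Computes w m D S R L) {T i : ℕ} (hT : (L q).program.length ≤ T)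
    (hi : 1 ≤ i) (hi' : i ≤ {y ∈ Finset.range m | HasBit q S y}.card) :
    Answers (L q).program T w D i (FID.select i {y ∈ Finset.range m | HasBit q S y}) := by
  obtain ⟨y, hy, hbit, rfl, hselect⟩ := exists_select_filter_range _ hi hi'
  rw [hselect]
  exact Expr.answers_program hT (h.eval_select q y hy hbit)

theorem represents (h : Computes w m D S R L) (hS : S ⊆ Finset.range m) :
    Represents (queries R L) (queryTime R L) w m D S where
  rankS x hx := by
    have hrank := h.answers_rank (q := true) (T := queryTime R L) (by rw [queryTime]; lia) hx
    rwa [filter_hasBit_true hS] at hrank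
  selectS i hi hi' := by
    have hselect := h.answers_select (q := true) (T := queryTime R L) (by rw [queryTime]; lia) hi
    rw [filter_hasBit_true hS] at hselect
    exact hselect hi'
  rankCompl x hx := by
    rw [← filter_hasBit_false]
    exact h.answers_rank (by rw [queryTime]; lia) hx
  selectCompl i hi hi' := by
    rw [← filter_hasBit_false] at hi' ⊢
    exact h.answers_select (by rw [queryTime]; lia) hi hi'

end Computes

theorem HasDictionary.computes {w t f m : ℕ} {S : Finset ℕ} {D : List Bool}
    (h : HasDictionary w t f (m / t + 1) S D) (hm : m < 2 ^ w) :
    Computes w m D S Expr.rank Expr.select where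
  eval_rank q y hy :=
    h.eval_rank (hasValue_arg (hy.trans hm)) (Nat.lt_succ_of_le (Nat.div_le_div_right hy.le))
  eval_select q y hy hbit := by
    have hle : Nat.count (HasBit q S) y ≤ y := Nat.count_le _
    have hend : m ≤ (m / t + 1) * t := by
      rw [add_one_mul]
      exact (Nat.lt_div_mul_add h.blockLength_pos).le
    have hlt : Nat.count (HasBit q S) y < FID.blockRank t (HasBit q S) (m / t + 1) :=
      (Nat.count_strict_mono hbit hy).trans_le (Nat.count_monotone _ hend)
    have hnth : Nat.nth (HasBit q S) (Nat.count (HasBit q S) y + 1 - 1) = y :=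
      Nat.nth_count hbit
    have hselect := h.select (q := q) (hasValue_arg (y := Nat.count (HasBit q S) y + 1) (by lia))
      (by lia) hlt (by lia)
    rw [hnth] at hselect
    exact hselect.eval_eq

/-! ### Small universes -/

/-- The memory for a small universe: a word `0` followed by the characteristic sequence of `S`,
one word for each element of the universe. -/
def bitmap (w m : ℕ) (S : Finset ℕ) : List Bool :=
  array w (m + 1) fun
    | 0 => 0
    | k + 1 => if k ∈ S then 1 else 0

namespace Expr

/-- Whether `k` belongs to the set (`q = true`) or to its complement, as a number `0` or `1`. -/
def bitmapEntry (q : Bool) (k : Expr) : Expr :=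
  if q then .load (k + .const 1) else .const 1 - .load (k + .const 1)

/-- The number of elements from `k` on below the argument, by inspection of at most `n`
positions. -/
def bitmapCount (q : Bool) : ℕ → ℕ → Expr
  | 0, _ => .const 0
  | n + 1, k => .ite (.const k) .arg (bitmapEntry q (.const k) + bitmapCount q n (k + 1)) (.const 0)

/-- The rank of the argument in a universe with at most `n` elements. -/
def bitmapRank (n : ℕ) (q : Bool) : Expr :=
  .ite (.const 0) (bitmapEntry q .arg) (bitmapCount q n 0) negOne

/-- The first position from `k` on where the number of elements, `j` of them before `k`, reaches
the argument, by inspection of at most `n` positions. -/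
def bitmapSelectFrom (q : Bool) : ℕ → ℕ → ℕ → Expr
  | 0, _, _ => .const 0
  | n + 1, k, j =>
    .ite (.const 0) (bitmapEntry q (.const k))
      (.ite (.const (j + 1)) .arg (bitmapSelectFrom q n (k + 1) (j + 1)) (.const k))
      (bitmapSelectFrom q n (k + 1) j)

/-- The answer to a select query in a universe with at most `n` elements. -/
def bitmapSelect (n : ℕ) (q : Bool) : Expr := bitmapSelectFrom q n 0 0

end Expr

section Bitmap

variable {w m k n y : ℕ} {S : Finset ℕ} {x : BitVec w} {q : Bool}

@[simp] theorem length_bitmap (w m : ℕ) (S : Finset ℕ) : (bitmap w m S).length = (m + 1) * w :=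
  length_array _ _ _

theorem readBits_bitmap_zero (w m : ℕ) (S : Finset ℕ) : readBits (bitmap w m S) (0 * w) w = 0 :=
  (containsAt_array _ m.succ_pos).readBits_eq (by positivity)

theorem readBits_bitmap_succ (hw : 0 < w) (S : Finset ℕ) (hk : k < m) :
    readBits (bitmap w m S) ((k + 1) * w) w = if k ∈ S then 1 else 0 :=
  have := Nat.one_lt_two_pow hw.ne'
  (containsAt_array _ (Nat.succ_lt_succ hk)).readBits_eq (by dsimp only; split_ifs <;> lia)

theorem hasValue_bitmapEntry (hw : 0 < w) (hm : m < 2 ^ w) {e : Expr}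
    (he : HasValue w (bitmap w m S) x e k) (hk : k < m) :
    HasValue w (bitmap w m S) x (.bitmapEntry q e) (if HasBit q S k then 1 else 0) := by
  have hone := hasValue_const (D := bitmap w m S) (x := x) (Nat.one_lt_two_pow hw.ne')
  have hload := (he.add hone (by lia)).load
  rw [readBits_bitmap_succ hw S hk] at hload
  cases q
  · have hsub := hone.sub hload (by split_ifs <;> lia)
    by_cases hkS : k ∈ S <;> simpa [Expr.bitmapEntry, HasBit, hkS] using hsub
  · simpa [Expr.bitmapEntry, HasBit] using hload

theorem hasValue_bitmapCount (hw : 0 < w) (hm : m < 2 ^ w)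
    (hy : HasValue w (bitmap w m S) x .arg y) (hym : y < m) (hk : k ≤ y) (hn : y - k ≤ n) :
    HasValue w (bitmap w m S) x (.bitmapCount q n k)
      (Nat.count (HasBit q S) y - Nat.count (HasBit q S) k) := by
  have hzero : HasValue w (bitmap w m S) x (.const 0) 0 := hasValue_const (by positivity)
  induction n generalizing k with
  | zero =>
    obtain rfl : k = y := by lia
    rwa [Nat.sub_self]
  | succ n ih =>
    have hconst : HasValue w (bitmap w m S) x (.const k) k := hasValue_const (by lia)
    rcases hk.lt_or_eq with hlt | rfl
    · have hle : Nat.count (HasBit q S) y ≤ y := Nat.count_le _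
      have hmono := Nat.count_monotone (HasBit q S) (Nat.succ_le_of_lt hlt)
      rw [Nat.succ_eq_add_one, Nat.count_succ] at hmono
      have hsum := (hasValue_bitmapEntry (q := q) hw hm hconst (hlt.trans hym)).add
        (ih hlt (by lia)) (by rw [Nat.count_succ]; lia)
      have hvalue : (if HasBit q S k then 1 else 0) +
          (Nat.count (HasBit q S) y - Nat.count (HasBit q S) (k + 1)) =
          Nat.count (HasBit q S) y - Nat.count (HasBit q S) k := by
        rw [Nat.count_succ]
        lia
      rw [hvalue] at hsum
      exact hconst.ite_of_lt hy hlt hsum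
    · rw [Nat.sub_self]
      exact hconst.ite_of_not_lt hy (lt_irrefl k) hzero

theorem hasValue_bitmapSelectFrom (hw : 0 < w) (hm : m < 2 ^ w) (hym : y < m)
    (hbit : HasBit q S y)
    (hx : HasValue w (bitmap w m S) x .arg (Nat.count (HasBit q S) y + 1)) (hk : k ≤ y)
    (hn : y - k < n) :
    HasValue w (bitmap w m S) x (.bitmapSelectFrom q n k (Nat.count (HasBit q S) k)) y := by
  have hzero : HasValue w (bitmap w m S) x (.const 0) 0 := hasValue_const (by positivity)
  induction n generalizing k with
  | zero => exact absurd hn (Nat.not_lt_zero _)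
  | succ n ih =>
    have hconst : HasValue w (bitmap w m S) x (.const k) k := hasValue_const (by lia)
    have hentry := hasValue_bitmapEntry (q := q) hw hm hconst (hk.trans_lt hym)
    have hcount : Nat.count (HasBit q S) k ≤ k := Nat.count_le _
    by_cases hkbit : HasBit q S k
    · have hsucc : Nat.count (HasBit q S) (k + 1) = Nat.count (HasBit q S) k + 1 := by
        rw [Nat.count_succ, if_pos hkbit]
      have hnext : HasValue w (bitmap w m S) x (.const (Nat.count (HasBit q S) k + 1))
          (Nat.count (HasBit q S) k + 1) := hasValue_const (by lia)
      rw [if_pos hkbit] at hentry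
      refine hzero.ite_of_lt hentry one_pos ?_
      rcases hk.lt_or_eq with hlt | rfl
      · have hmono := Nat.count_strict_mono hkbit hlt
        refine hnext.ite_of_lt hx (by lia) ?_
        rw [← hsucc]
        exact ih hlt (by lia)
      · exact hnext.ite_of_not_lt hx (lt_irrefl _) hconst
    · have hsucc : Nat.count (HasBit q S) (k + 1) = Nat.count (HasBit q S) k := by
        rw [Nat.count_succ, if_neg hkbit, add_zero]
      have hlt : k < y := hk.lt_of_ne fun h => hkbit (h ▸ hbit)
      rw [if_neg hkbit] at hentry
      refine hzero.ite_of_not_lt hentry (lt_irrefl 0) ?_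
      rw [← hsucc]
      exact ih hlt (by lia)

theorem computes_bitmap (hw : 0 < w) (hm : m < 2 ^ w) (S : Finset ℕ) (hn : m ≤ n) :
    Computes w m (bitmap w m S) S (Expr.bitmapRank n) (Expr.bitmapSelect n) where
  eval_rank q y hy := by
    have harg : HasValue w (bitmap w m S) (BitVec.ofNat w y) .arg y := hasValue_arg (hy.trans hm)
    have hzero : HasValue w (bitmap w m S) (BitVec.ofNat w y) (.const 0) 0 :=
      hasValue_const (by positivity)
    have hentry := hasValue_bitmapEntry (q := q) hw hm harg hy
    split_ifs with hbit
    · rw [if_pos hbit] at hentry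
      have hcount := hasValue_bitmapCount (q := q) hw hm harg hy y.zero_le (hy.le.trans hn)
      rw [Nat.count_zero, Nat.sub_zero] at hcount
      exact (hzero.ite_of_lt hentry one_pos hcount).eval_eq
    · rw [if_neg hbit] at hentry
      exact (hzero.eval_ite_of_not_lt hentry (lt_irrefl 0)).trans eval_negOne
  eval_select q y hy hbit := by
    have hle : Nat.count (HasBit q S) y ≤ y := Nat.count_le _
    have hselect := hasValue_bitmapSelectFrom hw hm hy hbit (hasValue_arg (by lia)) y.zero_le
      (hy.trans_le hn)
    rw [Nat.count_zero] at hselect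
    exact hselect.eval_eq

end Bitmap

/-! ### Two representations -/

/-- The expression `a q` if memory word `0` is nonzero and `b q` if it is zero. -/
def Expr.byFirstWord (a b : Bool → Expr) (q : Bool) : Expr :=
  .ite (.const 0) (.load (.const 0)) (a q) (b q)

section ByFirstWord

variable {w m : ℕ} {D : List Bool} {S : Finset ℕ} {R L R' L' : Bool → Expr} {q : Bool}

theorem eval_byFirstWord (x : BitVec w) (a b : Bool → Expr) :
    (Expr.byFirstWord a b q).eval (memOf w D) x =
      if 0 < readBits D (0 * w) w then (a q).eval (memOf w D) x else (b q).eval (memOf w D) x := by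
  have hzero : HasValue w D x (.const 0) 0 := hasValue_const (by positivity)
  split_ifs with h
  · exact hzero.eval_ite_of_lt hzero.load h
  · exact hzero.eval_ite_of_not_lt hzero.load h

theorem Computes.byFirstWord_left (h : Computes w m D S R L) (hD : 0 < readBits D (0 * w) w) :
    Computes w m D S (.byFirstWord R R') (.byFirstWord L L') where
  eval_rank q y hy := by
    rw [eval_byFirstWord, if_pos hD]
    exact h.eval_rank q y hy
  eval_select q y hy hbit := by
    rw [eval_byFirstWord, if_pos hD]
    exact h.eval_select q y hy hbit

theorem Computes.byFirstWord_right (h : Computes w m D S R' L') (hD : readBits D (0 * w) w = 0) :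
    Computes w m D S (.byFirstWord R R') (.byFirstWord L L') where
  eval_rank q y hy := by
    rw [eval_byFirstWord, if_neg hD.not_gt]
    exact h.eval_rank q y hy
  eval_select q y hy hbit := by
    rw [eval_byFirstWord, if_neg hD.not_gt]
    exact h.eval_select q y hy hbit

end ByFirstWord

/-! ### The parameters and the redundancy -/

/-- The block length for the universe `{0, …, m - 1}`. -/
def blockSize (m : ℕ) : ℕ := Nat.log 2 m / 8

/-- The length of short fields for the universe `{0, …, m - 1}`. -/
def fieldSize (m : ℕ) : ℕ := 4 * (Nat.log 2 (blockSize m) + 1)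

theorem exists_forall_le_blockSize (k : ℕ) : ∃ N, ∀ m ≥ N, k ≤ blockSize m :=
  ⟨2 ^ (k * 8), fun _ hm => (Nat.le_div_iff_mul_le (by norm_num)).mpr <|
    Nat.le_log_of_pow_le one_lt_two hm⟩

theorem blockSize_le_self (m : ℕ) : blockSize m ≤ m :=
  (Nat.div_le_self _ _).trans (Nat.log_le_self 2 m)

theorem two_pow_blockSize_le {m : ℕ} (hm : m ≠ 0) : 2 ^ (8 * blockSize m) ≤ m :=
  (Nat.pow_le_pow_right two_pos (Nat.mul_div_le _ 8)).trans (Nat.pow_log_le_self 2 hm)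

theorem eight_mul_blockSize_le {m w : ℕ} (hmw : m < 2 ^ w) : 8 * blockSize m ≤ w := by
  have hlog := Nat.log_mono_right (b := 2) hmw.le
  rw [Nat.log_pow one_lt_two] at hlog
  exact (Nat.mul_div_le _ 8).trans hlog

theorem blockSize_pow_four_le (m : ℕ) : blockSize m ^ 4 ≤ 2 ^ fieldSize m := by
  rw [fieldSize, mul_comm, pow_mul]
  exact Nat.pow_le_pow_left (Nat.lt_pow_succ_log_self one_lt_two _).le 4

theorem eight_mul_succ_le_two_pow {n : ℕ} (hn : 6 ≤ n) : 8 * (n + 1) ≤ 2 ^ n := by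
  induction n, hn using Nat.le_induction with
  | base => norm_num
  | succ n hn ih => rw [pow_succ]; lia

/-- The dictionary with the parameters for the universe `{0, …, m - 1}`. -/
noncomputable def fid (w m : ℕ) (S : Finset ℕ) : List Bool :=
  dictionary w (blockSize m) (fieldSize m) (m / blockSize m + 1) S

theorem readBits_fid_zero {w : ℕ} (hw : 0 < w) (m : ℕ) (S : Finset ℕ) :
    readBits (fid w m S) (0 * w) w = 1 :=
  readBits_layout (k := 0) (by lia) (Nat.one_lt_two_pow hw.ne')

section LargeUniverse

variable {m w c : ℕ} {S : Finset ℕ}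

theorem pos_of_le_blockSize (h : 1000 ≤ blockSize m) : 0 < m :=
  (by lia : 0 < blockSize m).trans_le (blockSize_le_self m)

theorem two_mul_fieldSize_le (h : 1000 ≤ blockSize m) : 2 * fieldSize m ≤ blockSize m := by
  have hlog : 6 ≤ Nat.log 2 (blockSize m) := Nat.le_log_of_pow_le one_lt_two (by lia)
  have hpow := Nat.pow_log_le_self 2 (x := blockSize m) (by lia)
  have := eight_mul_succ_le_two_pow hlog
  rw [fieldSize]
  lia

theorem admissible_blockSize (h : 1000 ≤ blockSize m) (hmw : m < 2 ^ w) :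
    Admissible w (blockSize m) (fieldSize m) where
  blockLength_le := eight_mul_blockSize_le hmw
  le_blockLength := by lia
  fieldLength_le := by have := two_mul_fieldSize_le h; lia
  blockLength_pow_le := blockSize_pow_four_le m

theorem pow_three_mul_two_pow_le (h : 1000 ≤ blockSize m) :
    blockSize m ^ 3 * 2 ^ (2 * blockSize m) ≤ m / blockSize m := by
  rw [Nat.le_div_iff_mul_le (by lia)]
  refine le_trans ?_ (two_pow_blockSize_le (pos_of_le_blockSize h).ne')
  set t := blockSize m
  calc t ^ 3 * 2 ^ (2 * t) * t = t ^ 4 * 2 ^ (2 * t) := by ring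
    _ ≤ (2 ^ t) ^ 4 * 2 ^ (2 * t) :=
      Nat.mul_le_mul_right _ (Nat.pow_le_pow_left Nat.lt_two_pow_self.le 4)
    _ = 2 ^ (6 * t) := by rw [← pow_mul, ← pow_add]; congr 1; ring
    _ ≤ 2 ^ (8 * t) := Nat.pow_le_pow_right two_pos (by lia)

theorem length_fid_le_codePosition (h : 1000 ≤ blockSize m) (hmw : m < 2 ^ w)
    (hwc : w ≤ c * blockSize m) (S : Finset ℕ) :
    (fid w m S).length ≤ codePosition (blockSize m) S (m / blockSize m + 1) +
      49 * c * ((m / blockSize m + 1) * fieldSize m) :=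
  length_dictionary_le (admissible_blockSize h hmw) hwc
    ((pow_three_mul_two_pow_le h).trans (Nat.le_succ _)) S

theorem length_fid_le (h : 1000 ≤ blockSize m) (hmw : m < 2 ^ w) (hwc : w ≤ c * blockSize m)
    (hS : S ⊆ Finset.range m) :
    (fid w m S).length ≤ infoBound S.card m +
      51 * c * ((m / blockSize m + 1) * fieldSize m) := by
  have hlength := length_fid_le_codePosition h hmw hwc S
  have hcode := codePosition_le_infoBound (blockSize m) hS
  have hblock : blockSize m ≤ m / blockSize m :=
    calc blockSize m ≤ blockSize m ^ 3 := Nat.le_self_pow (by norm_num) _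
      _ ≤ blockSize m ^ 3 * 2 ^ (2 * blockSize m) := Nat.le_mul_of_pos_right _ (by positivity)
      _ ≤ m / blockSize m := pow_three_mul_two_pow_le h
  have hc : 0 < c := Nat.pos_of_ne_zero fun hc => by
    have := (admissible_blockSize h hmw).wordSize_pos
    subst hc
    lia
  have hcount : m / blockSize m + 1 ≤ c * ((m / blockSize m + 1) * fieldSize m) :=
    (Nat.le_mul_of_pos_right _ (by rw [fieldSize]; lia)).trans (Nat.le_mul_of_pos_left _ hc)
  rw [mul_assoc] at hlength ⊢
  lia

theorem hundred_mul_div_blockSize_le (h : 1000 ≤ blockSize m) :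
    100 * (m / blockSize m + 1) ≤ m := by
  have hdiv : 1000 * (m / blockSize m) ≤ m :=
    (Nat.mul_le_mul_right _ h).trans (Nat.mul_div_le m _)
  have := blockSize_le_self m
  lia

theorem length_fid_add_lt (h : 1000 ≤ blockSize m) (hmw : m < 2 ^ w) (S : Finset ℕ) :
    (fid w m S).length + w < 2 ^ w * w := by
  have hadm := admissible_blockSize h hmw
  set t := blockSize m
  set f := fieldSize m
  set M := m / t + 1
  have hfield : (w / t + 1) * f ≤ 2 * w :=
    calc (w / t + 1) * f ≤ (w / t + 1) * t := Nat.mul_le_mul_left _ hadm.fieldLength_le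
      _ = w / t * t + t := add_one_mul _ _
      _ ≤ 2 * w := by have := Nat.div_mul_le_self w t; have := hadm.blockLength_le; lia
  have hcode : codePosition t S M ≤ M * w :=
    (codePosition_le t S M).trans (Nat.mul_le_mul_left _ (by have := hadm.blockLength_le; lia))
  have hwt : w ≤ (w / t + 1) * t := by
    rw [add_one_mul]
    exact (Nat.lt_div_mul_add hadm.blockLength_pos).le
  have hcount : 99 * M + 1 < 2 ^ w := by
    have : 100 * M ≤ m := hundred_mul_div_blockSize_le h
    lia
  calc (fid w m S).length + w
      ≤ codePosition t S M + 49 * (w / t + 1) * (M * f) + w :=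
        Nat.add_le_add_right (length_fid_le_codePosition h hmw hwt S) w
    _ = codePosition t S M + 49 * M * ((w / t + 1) * f) + w := by ring
    _ ≤ M * w + 49 * M * (2 * w) + w := by gcongr
    _ = (99 * M + 1) * w := by ring
    _ < 2 ^ w * w := Nat.mul_lt_mul_of_pos_right hcount hadm.wordSize_pos

theorem hasDictionary_fid (h : 1000 ≤ blockSize m) (hmw : m < 2 ^ w) (S : Finset ℕ) :
    HasDictionary w (blockSize m) (fieldSize m) (m / blockSize m + 1) S (fid w m S) := by
  have hfield : (m / blockSize m + 1) * (2 * fieldSize m) ≤ 2 * m :=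
    calc _ ≤ (m / blockSize m + 1) * blockSize m := Nat.mul_le_mul_left _ (two_mul_fieldSize_le h)
      _ = m / blockSize m * blockSize m + blockSize m := add_one_mul _ _
      _ ≤ 2 * m := by have := Nat.div_mul_le_self m (blockSize m); have := blockSize_le_self m; lia
  rw [mul_left_comm] at hfield
  refine hasDictionary_dictionary (admissible_blockSize h hmw) (by lia) (fun b hb => ?_)
    (length_fid_add_lt h hmw S)
  calc b * blockSize m ≤ m / blockSize m * blockSize m :=
        Nat.mul_le_mul_right _ (Nat.le_of_lt_succ hb)
    _ ≤ m := Nat.div_mul_le_self _ _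
    _ < 2 ^ w := hmw

theorem computes_fid (h : 1000 ≤ blockSize m) (hmw : m < 2 ^ w) (S : Finset ℕ) :
    Computes w m (fid w m S) S Expr.rank Expr.select :=
  (hasDictionary_fid h hmw S).computes hmw

end LargeUniverse

/-- The number of bits, up to a constant factor, that the dictionary uses in addition to the
information-theoretic bound. -/
noncomputable def redundancy (m : ℕ) : ℝ := m * lg (lg m) / lg m

theorem one_lt_lg_three : 1 < lg 3 := by
  rw [lg, Real.lt_logb_iff_rpow_lt one_lt_two (by norm_num)]
  norm_num

theorem lg_le_lg {x y : ℝ} (hx : 0 < x) (h : x ≤ y) : lg x ≤ lg y :=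
  Real.logb_le_logb_of_le one_lt_two hx h

theorem lg_natCast_nonneg (m : ℕ) : 0 ≤ lg m :=
  (Nat.cast_nonneg _).trans (Real.natLog_le_logb m 2)

theorem lg_natCast_le (m : ℕ) : lg m ≤ m := by
  rcases m.eq_zero_or_pos with rfl | hm
  · simp [lg]
  · rw [lg, Real.logb_le_iff_le_rpow one_lt_two (Nat.cast_pos.mpr hm), Real.rpow_natCast]
    exact_mod_cast Nat.lt_two_pow_self.le

theorem lg_lg_three_pos : 0 < lg (lg 3) := Real.logb_pos one_lt_two one_lt_lg_three

theorem lg_lg_three_le_redundancy {m : ℕ} (hm : 3 ≤ m) : lg (lg 3) ≤ redundancy m := by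
  have hlg3 := one_lt_lg_three
  have hlg : lg 3 ≤ lg m := lg_le_lg three_pos (by exact_mod_cast hm)
  rw [redundancy, le_div_iff₀ (by linarith), mul_comm]
  exact mul_le_mul (lg_natCast_le m) (lg_le_lg (by linarith) hlg) lg_lg_three_pos.le m.cast_nonneg

theorem length_bitmap_le {m N w : ℕ} {c : ℝ} (hm : 3 ≤ m) (hmN : m ≤ N)
    (hwc : (w : ℝ) ≤ c * lg m) (S : Finset ℕ) :
    ((bitmap w m S).length : ℝ) ≤ (N + 1) * (|c| * N) / lg (lg 3) * redundancy m := by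
  have hmN' : (m : ℝ) ≤ N := Nat.cast_le.mpr hmN
  have hw : (w : ℝ) ≤ |c| * N :=
    calc (w : ℝ) ≤ c * lg m := hwc
      _ ≤ |c| * N := mul_le_mul (le_abs_self c) ((lg_natCast_le m).trans hmN')
          (lg_natCast_nonneg m) (abs_nonneg c)
  have hlg3 := lg_lg_three_pos
  calc ((bitmap w m S).length : ℝ) = (m + 1) * w := by rw [length_bitmap]; push_cast; rfl
    _ ≤ (N + 1) * (|c| * N) := by gcongr
    _ = (N + 1) * (|c| * N) / lg (lg 3) * lg (lg 3) := (div_mul_cancel₀ _ hlg3.ne').symm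
    _ ≤ (N + 1) * (|c| * N) / lg (lg 3) * redundancy m :=
      mul_le_mul_of_nonneg_left (lg_lg_three_le_redundancy hm) (by positivity)

theorem lg_le_nine_mul_blockSize {m : ℕ} (h : 1000 ≤ blockSize m) : lg m ≤ 9 * blockSize m := by
  have hlog : Nat.log 2 m + 1 ≤ 9 * blockSize m := by rw [blockSize] at h ⊢; lia
  have hfloor : lg m < Nat.log 2 m + 1 := by
    rw [← Real.natFloor_logb_natCast]
    exact Nat.lt_floor_add_one _
  exact hfloor.le.trans (by exact_mod_cast hlog)

theorem fieldSize_le_lg_lg {m : ℕ} (h : 1000 ≤ blockSize m) :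
    (fieldSize m : ℝ) ≤ 4 * lg (lg m) := by
  have hblock : (0 : ℝ) < blockSize m := Nat.cast_pos.mpr (by lia)
  have hlg : (8 * blockSize m : ℝ) ≤ lg m :=
    le_trans (by exact_mod_cast Nat.mul_div_le _ 8) (Real.natLog_le_logb m 2)
  have hlglg : lg (2 * blockSize m) ≤ lg (lg m) := lg_le_lg (by positivity) (by linarith)
  have hlog : (Nat.log 2 (blockSize m) : ℝ) ≤ lg (blockSize m) := Real.natLog_le_logb _ 2
  have hdouble : lg (2 * blockSize m) = 1 + lg (blockSize m) := by
    rw [lg, Real.logb_mul two_ne_zero hblock.ne', Real.logb_self_eq_one one_lt_two, lg]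
  rw [fieldSize]
  push_cast
  linarith

theorem mul_fieldSize_le_redundancy {m : ℕ} (h : 1000 ≤ blockSize m) :
    (((m / blockSize m + 1) * fieldSize m : ℕ) : ℝ) ≤ 72 * redundancy m := by
  have hblock : (0 : ℝ) < blockSize m := Nat.cast_pos.mpr (by lia)
  have hlg : 0 < lg m :=
    Real.logb_pos one_lt_two (Nat.one_lt_cast.mpr (by have := blockSize_le_self m; lia))
  have hdiv : (1 : ℝ) ≤ m / blockSize m :=
    (one_le_div hblock).mpr (Nat.cast_le.mpr (blockSize_le_self m))
  have hcount : (m : ℝ) / blockSize m ≤ 9 * m / lg m := by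
    rw [div_le_div_iff₀ hblock hlg, mul_comm 9, mul_assoc]
    exact mul_le_mul_of_nonneg_left (lg_le_nine_mul_blockSize h) m.cast_nonneg
  calc (((m / blockSize m + 1) * fieldSize m : ℕ) : ℝ)
      = (((m / blockSize m : ℕ) : ℝ) + 1) * fieldSize m := by push_cast; rfl
    _ ≤ (m / blockSize m + 1) * fieldSize m := by gcongr; exact Nat.cast_div_le
    _ ≤ (2 * (9 * m / lg m)) * (4 * lg (lg m)) :=
        mul_le_mul (by linarith) (fieldSize_le_lg_lg h) (Nat.cast_nonneg _) (by positivity)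
    _ = 72 * redundancy m := by rw [redundancy]; ring

theorem wordSize_le_mul_blockSize {m w : ℕ} {c : ℝ} (h : 1000 ≤ blockSize m)
    (hwc : (w : ℝ) ≤ c * lg m) : w ≤ ⌈9 * c⌉₊ * blockSize m := by
  have hc : 9 * c ≤ ⌈9 * c⌉₊ := Nat.le_ceil _
  have hw : (w : ℝ) ≤ ⌈9 * c⌉₊ * blockSize m :=
    calc (w : ℝ) ≤ c * lg m := hwc
      _ ≤ ⌈9 * c⌉₊ / 9 * lg m :=
        mul_le_mul_of_nonneg_right (by linarith) (lg_natCast_nonneg m)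
      _ ≤ ⌈9 * c⌉₊ / 9 * (9 * blockSize m) :=
        mul_le_mul_of_nonneg_left (lg_le_nine_mul_blockSize h) (by positivity)
      _ = ⌈9 * c⌉₊ * blockSize m := by ring
  exact_mod_cast hw

theorem length_fid_le_redundancy {m w : ℕ} {c : ℝ} {S : Finset ℕ} (h : 1000 ≤ blockSize m)
    (hmw : m < 2 ^ w) (hwc : (w : ℝ) ≤ c * lg m) (hS : S ⊆ Finset.range m) :
    ((fid w m S).length : ℝ) ≤ infoBound S.card m + 51 * ⌈9 * c⌉₊ * 72 * redundancy m := by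
  have hlength := length_fid_le h hmw (wordSize_le_mul_blockSize h hwc) hS
  calc ((fid w m S).length : ℝ)
      ≤ infoBound S.card m +
          51 * ⌈9 * c⌉₊ * (((m / blockSize m + 1) * fieldSize m : ℕ) : ℝ) := by
        exact_mod_cast hlength
    _ ≤ infoBound S.card m + 51 * ⌈9 * c⌉₊ * (72 * redundancy m) := by
        gcongr
        exact mul_fieldSize_le_redundancy h
    _ = _ := by rw [← mul_assoc]

end FID

theorem mainTheorem3 :
    ∃ (Q : FID.Queries) (T : ℕ), ∀ c : ℝ, ∃ C : ℝ, ∀ m w n : ℕ,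
      3 ≤ m → m < 2 ^ w → (w : ℝ) ≤ c * FID.lg m →
      ∀ S : Finset ℕ, S ⊆ Finset.range m → S.card = n →
        ∃ D : List Bool,
          (D.length : ℝ) ≤ FID.infoBound n m + C * (m * FID.lg (FID.lg m) / FID.lg m) ∧
          FID.Represents Q T w m D S := by
  obtain ⟨N, hN⟩ := FID.exists_forall_le_blockSize 1000
  let R := FID.Expr.byFirstWord FID.Expr.rank (FID.Expr.bitmapRank N)
  let L := FID.Expr.byFirstWord FID.Expr.select (FID.Expr.bitmapSelect N)
  refine ⟨FID.queries R L, FID.queryTime R L, fun c => ?_⟩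
  refine ⟨max (51 * ⌈9 * c⌉₊ * 72) ((N + 1) * (|c| * N) / FID.lg (FID.lg 3)), ?_⟩
  rintro m w _ hm hmw hwc S hS rfl
  have hw : 0 < w := Nat.pos_of_ne_zero fun hw => by rw [hw, pow_zero] at hmw; lia
  have hred : 0 ≤ FID.redundancy m :=
    FID.lg_lg_three_pos.le.trans (FID.lg_lg_three_le_redundancy hm)
  rcases le_total N m with hNm | hmN
  · refine ⟨FID.fid w m S, (FID.length_fid_le_redundancy (hN m hNm) hmw hwc hS).trans ?_,
      ((FID.computes_fid (hN m hNm) hmw S).byFirstWord_left ?_).represents hS⟩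
    · exact add_le_add_right (mul_le_mul_of_nonneg_right (le_max_left _ _) hred) _
    · exact (FID.readBits_fid_zero hw m S).symm ▸ one_pos
  · refine ⟨FID.bitmap w m S, (FID.length_bitmap_le hm hmN hwc S).trans ?_,
      ((FID.computes_bitmap hw hmw S hmN).byFirstWord_right ?_).represents hS⟩
    · exact le_add_of_nonneg_of_le (Nat.cast_nonneg _)
        (mul_le_mul_of_nonneg_right (le_max_right _ _) hred)
    · exact FID.readBits_bitmap_zero w m S
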